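/- All polars are taken with respect to the standard pairing on $\mathbb R^n$: $K^\circ=\{p:\langle p,x\rangle\le 1\ \forall x\in K\}$. For a body $K$ let $g_K$ be the (gauge) norm with unit body $K$. A point $x\in\partial K$ is smooth if $g_K$ is differentiable at $x$ (for polytopes: $x$ lies in the relative interior of a facet), and then $n_K(x)=dg_K(x)$ is the outer normal. $K\oplus_1L$ and $K\oplus_\infty L$ are the unit bodies of the norms $g_K+g_L$ and $\max\{g_K,g_L\}$ on $\mathbb R^{k+l}$. Hanner polytopes are the bodies obtained from $[-1,1]\subset\mathbb R^1$ by the operations $\oplus_1$ and $\oplus_\infty$. The billiard rules in $K\times T$ take $(q,p)$ to $(q',p')$, where $q,q'$ are smooth points of $\partial K$, $p,p'$ are smooth points of $\partial T$, $p'-p=-\lambda n_K(q)$ and $q'-q=\mu\, n_T(p')$ for some $\lambda,\mu>0$. A classical billiard trajectory in $K\times T$ is a cyclic sequence $(q_i,p_i)$, $i\in\mathbb Z/m$, $m\ge2$, in which each $(q_i,p_i)$ is followed by $(q_{i+1},p_{i+1})$ according to these rules. It is simple if it does not pass the same route several times, that is, $(q_i)$ has no period smaller than $m$. **Theorem.**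 Let $K\subset\mathbb R^k$ and $L\subset\mathbb R^l$ be Hanner polytopes, let $Q^1=(q^1_i)$ with momenta $(p^1_i)$ and $Q^2=(q^2_i)$ with momenta $(p^2_i)$ be simple classical billiard trajectories in $K\times K^\circ$ and $L\times L^\circ$, and let $H=K\oplus_1L\subset\mathbb R^{k+l}$. Then for every $\alpha\in(0,1)$ and for all but finitely many $\beta\in(0,1)$ the initial data $$q_1=(\alpha q^1_1,(1-\alpha)q^2_1),\qquad p_1=(\beta p^1_1+(1-\beta)p^1_2,\;p^2_1)$$ has a unique infinite forward extension by the billiard rules in $H\times H^\circ$, and this extension is a simple classical billiard trajectory in $H\times H^\circ$ (traversed periodically) such that 1. the projection of its coordinate polygonal line on the first $k$ coordinates coincides with (in particular, is congruent to) $\alpha Q^1$, and the projection on the last $l$ coordinates coincides with (in particular, is congruent to) $(1-\alpha)Q^2$; 2. the projection of its momentum polygonal line on the first $k$ coordinates coincides with the momentum polygonal line of $Q^1$, and the projection on the last $l$ coordinates coincides with that of $Q^2$. Here two closed polygonal lines coincide if they are the same oriented closed line, each passed once, up to listing additional vertices on the edges and repeating vertices. -/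

import Mathlib

/-- The (one-sided) polar body of `K ⊆ ℝⁿ`, with `ℝⁿ` paired with itself by the dot product. -/
def polarBody {n : ℕ} (K : Set (Fin n → ℝ)) : Set (Fin n → ℝ) :=
  {p | ∀ x ∈ K, dotProduct p x ≤ 1}

/-- The projection of `ℝ^(k+l)` on the first `k` coordinates. -/
def firstPart {k l : ℕ} (x : Fin (k + l) → ℝ) : Fin k → ℝ := fun i => x (Fin.castAdd l i)

/-- The projection of `ℝ^(k+l)` on the last `l` coordinates. -/
def lastPart {k l : ℕ} (x : Fin (k + l) → ℝ) : Fin l → ℝ := fun j => x (Fin.natAdd k j)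

/-- `K ⊕₁ L`: the unit body of the sum of the norms with unit bodies `K` and `L`
(the norm with unit body `K` is the gauge of `K`). -/
def oplusOne {k l : ℕ} (K : Set (Fin k → ℝ)) (L : Set (Fin l → ℝ)) : Set (Fin (k + l) → ℝ) :=
  {x | gauge K (firstPart x) + gauge L (lastPart x) ≤ 1}

/-- `K ⊕_∞ L`: the unit body of the maximum of the norms with unit bodies `K` and `L`. -/
def oplusInf {k l : ℕ} (K : Set (Fin k → ℝ)) (L : Set (Fin l → ℝ)) : Set (Fin (k + l) → ℝ) :=
  {x | max (gauge K (firstPart x)) (gauge L (lastPart x)) ≤ 1}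

/-- Hanner polytopes: `[-1,1]` in dimension one, closed under `⊕₁` and `⊕_∞`. -/
inductive IsHanner : (n : ℕ) → Set (Fin n → ℝ) → Prop
  | segment : IsHanner 1 (Set.Icc (-1) 1)
  | sumOne {k l : ℕ} {K : Set (Fin k → ℝ)} {L : Set (Fin l → ℝ)} :
      IsHanner k K → IsHanner l L → IsHanner (k + l) (oplusOne K L)
  | sumInf {k l : ℕ} {K : Set (Fin k → ℝ)} {L : Set (Fin l → ℝ)} :
      IsHanner k K → IsHanner l L → IsHanner (k + l) (oplusInf K L)

/-- `x` lies on the smooth piece of `∂K`, i.e. the norm with unit body `K` has a differential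
at the boundary point `x`. For a polytope: `x` is in the relative interior of a facet. -/
def IsSmoothBoundaryPoint {n : ℕ} (K : Set (Fin n → ℝ)) (x : Fin n → ℝ) : Prop :=
  x ∈ frontier K ∧ DifferentiableAt ℝ (gauge K) x

/-- The outer normal `n_K(x)`: the differential at `x` of the norm with unit body `K`,
written as a vector through the dot product. -/
noncomputable def outerNormal {n : ℕ} (K : Set (Fin n → ℝ)) (x : Fin n → ℝ) : Fin n → ℝ :=
  fun i => fderiv ℝ (gauge K) x (Pi.single i 1)

/-- One step of the classical billiard in `K × T`, from `(q, p)` to `(q', p')`. The momentum `p`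
with which one arrives at `q` is reflected to `p' = p - a n_K(q)`, `a > 0`, and then one moves with
velocity `n_T(p')` to the next point `q' = q + b n_T(p')`, `b > 0`. All points lie on the smooth
pieces of the boundaries. -/
structure BilliardStep {n : ℕ} (K T : Set (Fin n → ℝ)) (q p q' p' : Fin n → ℝ) : Prop where
  smooth_q : IsSmoothBoundaryPoint K q
  smooth_p : IsSmoothBoundaryPoint T p
  smooth_q' : IsSmoothBoundaryPoint K q'
  smooth_p' : IsSmoothBoundaryPoint T p'
  reflect : ∃ a : ℝ, 0 < a ∧ p' - p = -(a • outerNormal K q)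
  move : ∃ b : ℝ, 0 < b ∧ q' - q = b • outerNormal T p'

/-- A closed classical billiard trajectory with `m` bounces: coordinates `q` and momenta `p`,
both indexed by the integers and `m`-periodic. -/
structure IsClassicalTrajectory {n : ℕ} (K T : Set (Fin n → ℝ)) (m : ℕ)
    (q p : ℤ → Fin n → ℝ) : Prop where
  two_le : 2 ≤ m
  periodic_q : ∀ i, q (i + m) = q i
  periodic_p : ∀ i, p (i + m) = p i
  step : ∀ i, BilliardStep K T (q i) (p i) (q (i + 1)) (p (i + 1))

/-- A closed classical trajectory is simple if it does not pass the same route several times,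
i.e. its cyclic sequence of bounce points has no period smaller than `m`. -/
structure IsSimpleClassicalTrajectory {n : ℕ} (K T : Set (Fin n → ℝ)) (m : ℕ)
    (q p : ℤ → Fin n → ℝ) : Prop extends IsClassicalTrajectory K T m q p where
  simple : ∀ d : ℕ, 0 < d → d < m → ¬ ∀ i, q (i + d) = q i

/-- The polygonal line with vertices `R i`, parametrized so that `R i` is passed at time `i`. -/
noncomputable def polygonPoint {n : ℕ} (R : ℤ → Fin n → ℝ) (t : ℝ) : Fin n → ℝ :=
  AffineMap.lineMap (R ⌊t⌋) (R (⌊t⌋ + 1)) (Int.fract t)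

/-- The closed polygonal line with the `N`-periodic vertex sequence `P` coincides with the one with
the `m`-periodic vertex sequence `R`, except that `P` may list extra (or repeated) vertices lying
on the edges of `R`: the vertices `P j` are the points of the line `R` at times `c j`, the times
are nondecreasing and include all integers (so that every vertex of `R` is listed), and the line
`R` is passed exactly once while `P` is passed once. -/
def SameClosedPolygon {n : ℕ} (N : ℕ) (P : ℤ → Fin n → ℝ) (m : ℕ) (R : ℤ → Fin n → ℝ) : Prop :=
  ∃ c : ℤ → ℝ, Monotone c ∧ (∀ j, c (j + N) = c j + m) ∧
    (∀ j, P j = polygonPoint R (c j)) ∧ ∀ i : ℤ, ∃ j, c j = i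

/-!
Measure time along a trajectory by the momentum: between two bounces `p` moves with velocity
`-n_K(q)`. By induction on the construction of a Hanner polytope, a closed trajectory in `K × K°`
is at the antipodal state `(-q, -p)` after time `2`; here exchanging `K` and `K°` amounts to
exchanging positions and momenta. So a simple trajectory closes up after time exactly `4`.

The normals of `K ⊕₁ L` are the pairs of normals of `K` and `L`, while those of its polar
`K° ⊕_∞ L°` have one component zero. Hence a trajectory in the sum consists of trajectories in the
two summands running simultaneously, in which each bounce moves only one of the two positions; in
particular no two bounces may happen at the same time. As `Q¹` and `Q²` have the same total time
`4`, they can run in this way with any delay for which no two of their bounces coincide, and `β`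
fixes the delay.
-/

open Set Filter Topology
open scoped Pointwise

/-! ### Norm bodies -/

/-- `K` is the closed unit body of a norm, namely of its gauge. -/
structure IsNormBody {E : Type*} [AddCommGroup E] [Module ℝ E] [TopologicalSpace E]
    (K : Set E) : Prop where
  convex : Convex ℝ K
  mem_nhds : K ∈ 𝓝 (0 : E)
  neg_mem : ∀ x ∈ K, -x ∈ K
  isClosed : IsClosed K
  gauge_pos : ∀ x, x ≠ 0 → 0 < gauge K x

namespace IsNormBody

variable {E : Type*} [AddCommGroup E] [Module ℝ E] [TopologicalSpace E] {K : Set E}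

theorem gauge_neg (hK : IsNormBody K) (x : E) : gauge K (-x) = gauge K x :=
  _root_.gauge_neg hK.neg_mem x

variable [ContinuousSMul ℝ E]

theorem gauge_add_le (hK : IsNormBody K) (x y : E) : gauge K (x + y) ≤ gauge K x + gauge K y :=
  _root_.gauge_add_le hK.convex (absorbent_nhds_zero hK.mem_nhds) x y

/-- The norm with unit body `K`, as a seminorm. -/
noncomputable def seminorm (hK : IsNormBody K) : Seminorm ℝ E :=
  gaugeSeminorm ((balanced_iff_neg_mem hK.convex).2 fun {x} => hK.neg_mem x) hK.convex
    (absorbent_nhds_zero hK.mem_nhds)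

theorem gauge_smul (hK : IsNormBody K) (c : ℝ) (x : E) : gauge K (c • x) = |c| * gauge K x :=
  map_smul_eq_mul hK.seminorm c x

theorem gauge_smul_of_pos (hK : IsNormBody K) {c : ℝ} (hc : 0 < c) (x : E) :
    gauge K (c • x) = c * gauge K x := by
  rw [hK.gauge_smul, abs_of_pos hc]

theorem convexOn_gauge (hK : IsNormBody K) : ConvexOn ℝ univ (gauge K) :=
  hK.seminorm.convexOn

variable [IsTopologicalAddGroup E]

theorem gauge_le_one_iff (hK : IsNormBody K) {x : E} : gauge K x ≤ 1 ↔ x ∈ K := by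
  rw [gauge_le_one_iff_mem_closure hK.convex hK.mem_nhds, hK.isClosed.closure_eq]

theorem mem_frontier_iff (hK : IsNormBody K) {x : E} : x ∈ frontier K ↔ gauge K x = 1 :=
  (gauge_eq_one_iff_mem_frontier hK.convex hK.mem_nhds).symm

theorem continuous_gauge (hK : IsNormBody K) : Continuous (gauge K) :=
  _root_.continuous_gauge hK.convex hK.mem_nhds

end IsNormBody

section Seminorm

variable {E : Type*} [AddCommGroup E] [Module ℝ E]

theorem gauge_setOf_seminorm_le_one (p : Seminorm ℝ E) : gauge {x | p x ≤ 1} = p := by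
  ext x
  have mem_smul_iff (r : ℝ) (hr : 0 < r) : x ∈ r • {x | p x ≤ 1} ↔ p x ≤ r := by
    rw [mem_smul_set_iff_inv_smul_mem₀ hr.ne', mem_ofPred_eq, map_smul_eq_mul, norm_inv,
      Real.norm_of_nonneg hr.le, inv_mul_le_iff₀ hr, mul_one]
  refine le_antisymm (le_of_forall_pos_le_add fun ε hε => ?_) ?_
  · have hpos : 0 < p x + ε := add_pos_of_nonneg_of_pos (apply_nonneg p x) hε
    exact gauge_le_of_mem hpos.le ((mem_smul_iff _ hpos).2 (by linarith))
  · have hpos : 0 < p x + 1 := add_pos_of_nonneg_of_pos (apply_nonneg p x) one_pos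
    exact le_csInf ⟨p x + 1, hpos, (mem_smul_iff _ hpos).2 (by linarith)⟩
      fun r hr => (mem_smul_iff r hr.1).1 hr.2

theorem isNormBody_setOf_seminorm_le_one [TopologicalSpace E] {p : Seminorm ℝ E}
    (hcont : Continuous p) (hpos : ∀ x, x ≠ 0 → 0 < p x) : IsNormBody {x | p x ≤ 1} where
  convex := by simpa using p.convexOn.convex_le 1
  mem_nhds := by
    filter_upwards [hcont.continuousAt.eventually_lt continuousAt_const
      (show p 0 < 1 by simp)] with x hx using hx.le
  neg_mem x hx := by simpa using hx
  isClosed := isClosed_le hcont continuous_const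
  gauge_pos := by rwa [gauge_setOf_seminorm_le_one]

end Seminorm

/-! ### Coordinates of a direct sum -/

section Parts

variable {k l : ℕ}

@[simp] theorem firstPart_append (x : Fin k → ℝ) (y : Fin l → ℝ) :
    firstPart (Fin.append x y) = x := by
  ext i
  simp [firstPart]

@[simp] theorem lastPart_append (x : Fin k → ℝ) (y : Fin l → ℝ) :
    lastPart (Fin.append x y) = y := by
  ext i
  simp [lastPart]

@[simp] theorem append_firstPart_lastPart (z : Fin (k + l) → ℝ) :
    Fin.append (firstPart z) (lastPart z) = z :=
  Fin.append_castAdd_natAdd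

theorem parts_ext {z w : Fin (k + l) → ℝ} (hfirst : firstPart z = firstPart w)
    (hlast : lastPart z = lastPart w) : z = w := by
  rw [← append_firstPart_lastPart z, hfirst, hlast, append_firstPart_lastPart]

theorem dotProduct_eq_add (z w : Fin (k + l) → ℝ) :
    z ⬝ᵥ w = firstPart z ⬝ᵥ firstPart w + lastPart z ⬝ᵥ lastPart w := by
  simp [dotProduct, Fin.sum_univ_add, firstPart, lastPart]

@[simp] theorem firstPart_add (z w : Fin (k + l) → ℝ) :
    firstPart (z + w) = firstPart z + firstPart w := rfl

@[simp] theorem lastPart_add (z w : Fin (k + l) → ℝ) :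
    lastPart (z + w) = lastPart z + lastPart w := rfl

@[simp] theorem firstPart_sub (z w : Fin (k + l) → ℝ) :
    firstPart (z - w) = firstPart z - firstPart w := rfl

@[simp] theorem lastPart_sub (z w : Fin (k + l) → ℝ) :
    lastPart (z - w) = lastPart z - lastPart w := rfl

@[simp] theorem firstPart_smul (c : ℝ) (z : Fin (k + l) → ℝ) :
    firstPart (c • z) = c • firstPart z := rfl

@[simp] theorem lastPart_smul (c : ℝ) (z : Fin (k + l) → ℝ) :
    lastPart (c • z) = c • lastPart z := rfl

/-- The projection `firstPart` as a continuous linear map. -/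
def firstPartCLM (k l : ℕ) : (Fin (k + l) → ℝ) →L[ℝ] Fin k → ℝ :=
  ContinuousLinearMap.pi fun i => ContinuousLinearMap.proj (Fin.castAdd l i)

/-- The projection `lastPart` as a continuous linear map. -/
def lastPartCLM (k l : ℕ) : (Fin (k + l) → ℝ) →L[ℝ] Fin l → ℝ :=
  ContinuousLinearMap.pi fun j => ContinuousLinearMap.proj (Fin.natAdd k j)

/-- The concatenation `Fin.append` as a continuous linear map. -/
noncomputable def appendCLM (k l : ℕ) : (Fin k → ℝ) × (Fin l → ℝ) →L[ℝ] Fin (k + l) → ℝ :=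
  LinearMap.toContinuousLinearMap
    { toFun := fun z => Fin.append z.1 z.2
      map_add' := fun _ _ => parts_ext (by simp) (by simp)
      map_smul' := fun _ _ => parts_ext (by simp) (by simp) }

@[simp] theorem appendCLM_apply (z : (Fin k → ℝ) × (Fin l → ℝ)) :
    appendCLM k l z = Fin.append z.1 z.2 := rfl

@[simp] theorem coe_firstPartCLM : ⇑(firstPartCLM k l) = firstPart := rfl

@[simp] theorem coe_lastPartCLM : ⇑(lastPartCLM k l) = lastPart := rfl

theorem firstPart_ne_zero_or_lastPart_ne_zero {z : Fin (k + l) → ℝ} (hz : z ≠ 0) :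
    firstPart z ≠ 0 ∨ lastPart z ≠ 0 := by
  by_contra! h
  exact hz (parts_ext h.1 h.2)

variable {K : Set (Fin k → ℝ)} {L : Set (Fin l → ℝ)}

/-- The norm with unit body `K ⊕₁ L`. -/
noncomputable def oplusOneSeminorm (hK : IsNormBody K) (hL : IsNormBody L) :
    Seminorm ℝ (Fin (k + l) → ℝ) :=
  hK.seminorm.comp (firstPartCLM k l).toLinearMap + hL.seminorm.comp (lastPartCLM k l).toLinearMap

/-- The norm with unit body `K ⊕_∞ L`. -/
noncomputable def oplusInfSeminorm (hK : IsNormBody K) (hL : IsNormBody L) :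
    Seminorm ℝ (Fin (k + l) → ℝ) :=
  hK.seminorm.comp (firstPartCLM k l).toLinearMap ⊔ hL.seminorm.comp (lastPartCLM k l).toLinearMap

theorem gauge_oplusOne (hK : IsNormBody K) (hL : IsNormBody L) (x : Fin (k + l) → ℝ) :
    gauge (oplusOne K L) x = gauge K (firstPart x) + gauge L (lastPart x) :=
  congrFun (gauge_setOf_seminorm_le_one (oplusOneSeminorm hK hL)) x

theorem gauge_oplusInf (hK : IsNormBody K) (hL : IsNormBody L) (x : Fin (k + l) → ℝ) :
    gauge (oplusInf K L) x = max (gauge K (firstPart x)) (gauge L (lastPart x)) :=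
  congrFun (gauge_setOf_seminorm_le_one (oplusInfSeminorm hK hL)) x

theorem IsNormBody.oplusOne (hK : IsNormBody K) (hL : IsNormBody L) :
    IsNormBody (oplusOne K L) :=
  isNormBody_setOf_seminorm_le_one (p := oplusOneSeminorm hK hL)
    ((hK.continuous_gauge.comp (firstPartCLM k l).continuous).add
      (hL.continuous_gauge.comp (lastPartCLM k l).continuous))
    fun _ hx => (firstPart_ne_zero_or_lastPart_ne_zero hx).elim
      (fun h => add_pos_of_pos_of_nonneg (hK.gauge_pos _ h) (gauge_nonneg _))
      (fun h => add_pos_of_nonneg_of_pos (gauge_nonneg _) (hL.gauge_pos _ h))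

theorem IsNormBody.oplusInf (hK : IsNormBody K) (hL : IsNormBody L) :
    IsNormBody (oplusInf K L) :=
  isNormBody_setOf_seminorm_le_one (p := oplusInfSeminorm hK hL)
    ((hK.continuous_gauge.comp (firstPartCLM k l).continuous).max
      (hL.continuous_gauge.comp (lastPartCLM k l).continuous))
    fun _ hx => (firstPart_ne_zero_or_lastPart_ne_zero hx).elim
      (fun h => lt_max_of_lt_left (hK.gauge_pos _ h))
      (fun h => lt_max_of_lt_right (hL.gauge_pos _ h))

end Parts

section Segment

theorem segment_eq_closedBall :
    Icc (-1 : Fin 1 → ℝ) 1 = Metric.closedBall 0 1 := by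
  ext x
  simp [Pi.le_def, pi_norm_le_iff_of_nonneg, abs_le]

theorem gauge_segment (x : Fin 1 → ℝ) : gauge (Icc (-1 : Fin 1 → ℝ) 1) x = |x 0| := by
  rw [segment_eq_closedBall, gauge_closedBall zero_le_one, div_one, Pi.norm_def]
  simp

theorem isNormBody_segment : IsNormBody (Icc (-1 : Fin 1 → ℝ) 1) := by
  rw [segment_eq_closedBall]
  exact {
    convex := convex_closedBall 0 1
    mem_nhds := Metric.closedBall_mem_nhds 0 one_pos
    neg_mem := by simp
    isClosed := Metric.isClosed_closedBall
    gauge_pos := fun x hx => by simpa [gauge_closedBall] }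

theorem mem_segment_iff {x : Fin 1 → ℝ} : x ∈ Icc (-1 : Fin 1 → ℝ) 1 ↔ |x 0| ≤ 1 := by
  rw [← isNormBody_segment.gauge_le_one_iff, gauge_segment]

end Segment

/-! ### Polars -/

section Polar

variable {n k l : ℕ}

theorem polarBody_segment : polarBody (Icc (-1 : Fin 1 → ℝ) 1) = Icc (-1 : Fin 1 → ℝ) 1 := by
  ext p
  rw [mem_segment_iff]
  refine ⟨fun hp => abs_le.2 ?_, fun hp x hx => ?_⟩
  · have h₁ := hp 1 (mem_segment_iff.2 (by simp))
    have h₂ := hp (-1) (mem_segment_iff.2 (by simp))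
    simp only [dotProduct_one, dotProduct_neg, Fin.sum_univ_one] at h₁ h₂
    exact ⟨by linarith, h₁⟩
  · calc p ⬝ᵥ x = p 0 * x 0 := by simp [dotProduct]
      _ ≤ |p 0| * |x 0| := by rw [← abs_mul]; exact le_abs_self _
      _ ≤ 1 := mul_le_one₀ hp (abs_nonneg _) (mem_segment_iff.1 hx)

theorem gauge_polarBody_le {K : Set (Fin n → ℝ)} {p : Fin n → ℝ} {c : ℝ} (hc : 0 ≤ c)
    (h : ∀ x ∈ K, p ⬝ᵥ x ≤ c) : gauge (polarBody K) p ≤ c := by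
  refine le_of_forall_pos_le_add fun ε hε => gauge_le_of_mem (by positivity) ?_
  have hpos : 0 < c + ε := by positivity
  rw [mem_smul_set_iff_inv_smul_mem₀ hpos.ne']
  intro x hx
  rw [smul_dotProduct, smul_eq_mul, inv_mul_le_iff₀ hpos, mul_one]
  linarith [h x hx]

theorem dotProduct_le_gauge {K : Set (Fin n → ℝ)} (hK : IsNormBody K) {p : Fin n → ℝ}
    (hp : p ∈ polarBody K) (x : Fin n → ℝ) : p ⬝ᵥ x ≤ gauge K x := by
  rcases eq_or_ne x 0 with rfl | hx
  · simp
  have hpos := hK.gauge_pos x hx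
  have hmem : (gauge K x)⁻¹ • x ∈ K := by
    rw [← hK.gauge_le_one_iff, hK.gauge_smul_of_pos (inv_pos.2 hpos), inv_mul_cancel₀ hpos.ne']
  simpa [inv_mul_le_iff₀ hpos] using hp _ hmem

theorem dotProduct_le_gauge_polarBody {K : Set (Fin n → ℝ)} (hK : IsNormBody (polarBody K))
    (p : Fin n → ℝ) {x : Fin n → ℝ} (hx : x ∈ K) : p ⬝ᵥ x ≤ gauge (polarBody K) p := by
  rw [dotProduct_comm]
  refine dotProduct_le_gauge hK (fun q hq => ?_) p
  rw [dotProduct_comm]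
  exact hq x hx

variable {K : Set (Fin k → ℝ)} {L : Set (Fin l → ℝ)}

theorem polarBody_oplusOne (hK : IsNormBody K) (hL : IsNormBody L)
    (hK' : IsNormBody (polarBody K)) (hL' : IsNormBody (polarBody L)) :
    polarBody (oplusOne K L) = oplusInf (polarBody K) (polarBody L) := by
  ext p
  simp only [oplusInf, mem_ofPred_eq, max_le_iff, hK'.gauge_le_one_iff, hL'.gauge_le_one_iff]
  refine ⟨fun hp => ⟨fun x hx => ?_, fun y hy => ?_⟩, fun ⟨hp₁, hp₂⟩ x hx => ?_⟩
  · simpa [dotProduct_eq_add] using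
      hp (Fin.append x 0) (by simpa [oplusOne] using hK.gauge_le_one_iff.2 hx)
  · simpa [dotProduct_eq_add] using
      hp (Fin.append 0 y) (by simpa [oplusOne] using hL.gauge_le_one_iff.2 hy)
  · calc p ⬝ᵥ x ≤ gauge K (firstPart x) + gauge L (lastPart x) := by
          rw [dotProduct_eq_add]
          exact add_le_add (dotProduct_le_gauge hK hp₁ _) (dotProduct_le_gauge hL hp₂ _)
      _ ≤ 1 := hx

theorem polarBody_oplusInf (hK : IsNormBody K) (hL : IsNormBody L)
    (hK' : IsNormBody (polarBody K)) (hL' : IsNormBody (polarBody L)) :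
    polarBody (oplusInf K L) = oplusOne (polarBody K) (polarBody L) := by
  ext p
  refine ⟨fun hp => ?_, fun hp z hz => ?_⟩
  · have le_one (x) (hx : x ∈ K) (y) (hy : y ∈ L) : firstPart p ⬝ᵥ x + lastPart p ⬝ᵥ y ≤ 1 := by
      simpa [dotProduct_eq_add] using hp (Fin.append x y)
        (by simpa [oplusInf] using ⟨hK.gauge_le_one_iff.2 hx, hL.gauge_le_one_iff.2 hy⟩)
    have zero_mem_K : (0 : Fin k → ℝ) ∈ K := mem_of_mem_nhds hK.mem_nhds
    have zero_mem_L : (0 : Fin l → ℝ) ∈ L := mem_of_mem_nhds hL.mem_nhds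
    have first_le (y) (hy : y ∈ L) : gauge (polarBody K) (firstPart p) ≤ 1 - lastPart p ⬝ᵥ y :=
      gauge_polarBody_le (by simpa using le_one 0 zero_mem_K y hy)
        fun x hx => by linarith [le_one x hx y hy]
    have last_le : gauge (polarBody L) (lastPart p) ≤ 1 - gauge (polarBody K) (firstPart p) :=
      gauge_polarBody_le (by simpa using first_le 0 zero_mem_L)
        fun y hy => by linarith [first_le y hy]
    exact le_sub_iff_add_le'.1 last_le
  · obtain ⟨hz₁, hz₂⟩ := max_le_iff.1 (mem_ofPred_eq ▸ hz : max _ _ ≤ (1 : ℝ))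
    calc p ⬝ᵥ z ≤ gauge (polarBody K) (firstPart p) + gauge (polarBody L) (lastPart p) := by
          rw [dotProduct_eq_add]
          exact add_le_add (dotProduct_le_gauge_polarBody hK' _ (hK.gauge_le_one_iff.1 hz₁))
            (dotProduct_le_gauge_polarBody hL' _ (hL.gauge_le_one_iff.1 hz₂))
      _ ≤ 1 := hp

end Polar

/-- Polar pairs of Hanner polytopes, generated so as to be visibly symmetric under
`(K, T) ↦ (T, K)`. -/
inductive IsHannerPair : (n : ℕ) → Set (Fin n → ℝ) → Set (Fin n → ℝ) → Prop
  | segment : IsHannerPair 1 (Icc (-1) 1) (Icc (-1) 1)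
  | symm {n : ℕ} {K T : Set (Fin n → ℝ)} : IsHannerPair n K T → IsHannerPair n T K
  | sum {k l : ℕ} {K T : Set (Fin k → ℝ)} {L S : Set (Fin l → ℝ)} :
      IsHannerPair k K T → IsHannerPair l L S →
        IsHannerPair (k + l) (oplusOne K L) (oplusInf T S)

namespace IsHannerPair

variable {n : ℕ} {K T : Set (Fin n → ℝ)}

theorem isNormBody (h : IsHannerPair n K T) : IsNormBody K ∧ IsNormBody T := by
  induction h with
  | segment => exact ⟨isNormBody_segment, isNormBody_segment⟩
  | symm _ ih => exact ih.symm
  | sum _ _ ih₁ ih₂ => exact ⟨ih₁.1.oplusOne ih₂.1, ih₁.2.oplusInf ih₂.2⟩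

theorem dim_pos (h : IsHannerPair n K T) : 0 < n := by
  induction h with
  | segment => exact one_pos
  | symm _ ih => exact ih
  | sum _ _ ih₁ _ => exact Nat.add_pos_left ih₁ _

end IsHannerPair

theorem IsHanner.isHannerPair {n : ℕ} {K : Set (Fin n → ℝ)} (h : IsHanner n K) :
    IsHannerPair n K (polarBody K) := by
  induction h with
  | segment => exact polarBody_segment.symm ▸ .segment
  | sumOne _ _ ih₁ ih₂ =>
    rw [polarBody_oplusOne ih₁.isNormBody.1 ih₂.isNormBody.1 ih₁.isNormBody.2 ih₂.isNormBody.2]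
    exact ih₁.sum ih₂
  | sumInf _ _ ih₁ ih₂ =>
    rw [polarBody_oplusInf ih₁.isNormBody.1 ih₂.isNormBody.1 ih₁.isNormBody.2 ih₂.isNormBody.2]
    exact (ih₁.symm.sum ih₂.symm).symm

/-! ### Outer normals -/

/-- The linear functional `v ↦ w ⬝ᵥ v`. -/
noncomputable def dotCLM {n : ℕ} (w : Fin n → ℝ) : (Fin n → ℝ) →L[ℝ] ℝ :=
  LinearMap.toContinuousLinearMap (dotProductEquiv ℝ (Fin n) w)

@[simp] theorem dotCLM_apply {n : ℕ} (w v : Fin n → ℝ) : dotCLM w v = w ⬝ᵥ v := rfl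

theorem dotCLM_injective {n : ℕ} : Function.Injective (dotCLM (n := n)) :=
  LinearMap.toContinuousLinearMap.injective.comp (dotProductEquiv ℝ (Fin n)).injective

/-- `w` is the differential at `x` of the norm with unit body `K`. -/
def HasNormal {n : ℕ} (K : Set (Fin n → ℝ)) (x w : Fin n → ℝ) : Prop :=
  HasFDerivAt (gauge K) (dotCLM w) x

theorem hasNormal_outerNormal {n : ℕ} {K : Set (Fin n → ℝ)} {x : Fin n → ℝ}
    (hx : DifferentiableAt ℝ (gauge K) x) : HasNormal K x (outerNormal K x) := by
  have dotCLM_outerNormal : dotCLM (outerNormal K x) = fderiv ℝ (gauge K) x :=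
    ContinuousLinearMap.coe_injective <|
      (Pi.basisFun ℝ (Fin n)).ext fun i => by simp [outerNormal]
  rw [HasNormal, dotCLM_outerNormal]
  exact hx.hasFDerivAt

theorem IsSmoothBoundaryPoint.hasNormal {n : ℕ} {K : Set (Fin n → ℝ)} {x : Fin n → ℝ}
    (hx : IsSmoothBoundaryPoint K x) : HasNormal K x (outerNormal K x) :=
  hasNormal_outerNormal hx.2

theorem IsSmoothBoundaryPoint.gauge_eq_one {n : ℕ} {K : Set (Fin n → ℝ)} {x : Fin n → ℝ}
    (hx : IsSmoothBoundaryPoint K x) (hK : IsNormBody K) : gauge K x = 1 :=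
  hK.mem_frontier_iff.1 hx.1

namespace HasNormal

variable {n : ℕ} {K : Set (Fin n → ℝ)} {x w : Fin n → ℝ}

theorem unique {w' : Fin n → ℝ} (h : HasNormal K x w) (h' : HasNormal K x w') : w = w' :=
  dotCLM_injective (HasFDerivAt.unique h h')

theorem outerNormal_eq (h : HasNormal K x w) : outerNormal K x = w :=
  (hasNormal_outerNormal h.differentiableAt).unique h

theorem isSmoothBoundaryPoint (h : HasNormal K x w) (hK : IsNormBody K) (hx : gauge K x = 1) :
    IsSmoothBoundaryPoint K x :=
  ⟨hK.mem_frontier_iff.2 hx, h.differentiableAt⟩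

theorem hasDerivAt (h : HasNormal K x w) (d : Fin n → ℝ) :
    HasDerivAt (fun t : ℝ => gauge K (x + t • d)) (w ⬝ᵥ d) 0 := by
  have hasDerivAt_line : HasDerivAt (fun t : ℝ => x + t • d) d 0 := by
    simpa using ((hasDerivAt_id (0 : ℝ)).smul_const d).const_add x
  have h₀ : HasFDerivAt (gauge K) (dotCLM w) (x + (0 : ℝ) • d) := by rwa [zero_smul, add_zero]
  exact h₀.comp_hasDerivAt (0 : ℝ) hasDerivAt_line

/-- Euler's relation for the positively homogeneous function `gauge K`. -/
theorem dotProduct_self (h : HasNormal K x w) : w ⬝ᵥ x = gauge K x := by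
  have hasDerivAt_scaling : HasDerivAt (fun t : ℝ => (1 + t) * gauge K x) (gauge K x) 0 := by
    simpa using ((hasDerivAt_id (0 : ℝ)).const_add 1).mul_const (gauge K x)
  refine (h.hasDerivAt x).unique (hasDerivAt_scaling.congr_of_eventuallyEq ?_)
  filter_upwards [lt_mem_nhds (show (-1 : ℝ) < 0 by simp)] with t ht
  rw [← smul_eq_mul, ← gauge_smul_of_nonneg (by linarith), add_smul, one_smul]

theorem smul (h : HasNormal K x w) {c : ℝ} (hc : 0 < c) : HasNormal K (c • x) w := by
  have h₀ : HasFDerivAt (gauge K) (dotCLM w) (c⁻¹ • c • x) := by rwa [inv_smul_smul₀ hc.ne']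
  have hscaled := (h₀.comp (c • x) ((hasFDerivAt_id (c • x)).const_smul c⁻¹)).const_smul c
  refine (hscaled.congr_fderiv ?_).congr_of_eventuallyEq (.of_forall fun y => ?_)
  · ext i
    simp [hc.ne']
  · simp [gauge_smul_of_nonneg (inv_nonneg.2 hc.le), hc.ne']

theorem neg (h : HasNormal K x w) (hK : IsNormBody K) : HasNormal K (-x) (-w) := by
  have h₀ : HasFDerivAt (gauge K) (dotCLM w) (-(-x)) := by rwa [neg_neg]
  have hneg := h₀.comp (-x) (hasFDerivAt_id (-x)).neg
  refine (hneg.congr_fderiv ?_).congr_of_eventuallyEq (.of_forall fun y => ?_)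
  · ext i
    simp
  · simp [hK.gauge_neg]

theorem dotProduct_le (h : HasNormal K x w) (hK : IsNormBody K) (y : Fin n → ℝ) :
    w ⬝ᵥ y ≤ gauge K y := by
  refine le_of_tendsto (h.hasDerivAt y).tendsto_slope_zero_right ?_
  filter_upwards [self_mem_nhdsWithin] with t (ht : 0 < t)
  have := hK.gauge_add_le x (t • y)
  rw [hK.gauge_smul_of_pos ht] at this
  rw [zero_add, zero_smul, add_zero, smul_eq_mul, inv_mul_le_iff₀ ht]
  linarith

theorem mem_polarBody (h : HasNormal K x w) (hK : IsNormBody K) : w ∈ polarBody K :=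
  fun y hy => (h.dotProduct_le hK y).trans (gauge_le_one_of_mem hy)

theorem point_ne_zero (h : HasNormal K x w) (hK : IsNormBody K) (hn : 0 < n) : x ≠ 0 := by
  rintro rfl
  have : Nonempty (Fin n) := ⟨⟨0, hn⟩⟩
  obtain ⟨z, hz⟩ := exists_ne (0 : Fin n → ℝ)
  have hpos := hK.gauge_pos z hz
  refine not_differentiableAt_abs_zero
    (((h.hasDerivAt z).differentiableAt.mul_const (gauge K z)⁻¹).congr_of_eventuallyEq
      (.of_forall fun t => ?_))
  simp [hK.gauge_smul, hpos.ne']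

theorem ne_zero (h : HasNormal K x w) (hx : 0 < gauge K x) : w ≠ 0 := by
  rintro rfl
  simp [← h.dotProduct_self] at hx

end HasNormal

theorem IsSmoothBoundaryPoint.neg {n : ℕ} {K : Set (Fin n → ℝ)} {x : Fin n → ℝ}
    (hx : IsSmoothBoundaryPoint K x) (hK : IsNormBody K) : IsSmoothBoundaryPoint K (-x) :=
  (hx.hasNormal.neg hK).isSmoothBoundaryPoint hK (by rw [hK.gauge_neg, hx.gauge_eq_one hK])

section Sums

variable {k l : ℕ}

theorem hasFDerivAt_add_parts_iff {f : (Fin k → ℝ) → ℝ} {g : (Fin l → ℝ) → ℝ}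
    {z w : Fin (k + l) → ℝ} :
    HasFDerivAt (fun x => f (firstPart x) + g (lastPart x)) (dotCLM w) z ↔
      HasFDerivAt f (dotCLM (firstPart w)) (firstPart z) ∧
        HasFDerivAt g (dotCLM (lastPart w)) (lastPart z) := by
  refine ⟨fun h => ?_, fun ⟨hf, hg⟩ => ?_⟩
  · rw [← append_firstPart_lastPart z] at h
    constructor
    · have hcomp := (h.comp (firstPart z) ((appendCLM k l).hasFDerivAt.comp (firstPart z)
        (hasFDerivAt_prodMk_left (firstPart z) (lastPart z)))).sub_const (g (lastPart z))
      refine (hcomp.congr_fderiv ?_).congr_of_eventuallyEq (.of_forall fun x => ?_)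
      · ext i
        simp [dotProduct_eq_add]
      · simp
    · have hcomp := (h.comp (lastPart z) ((appendCLM k l).hasFDerivAt.comp (lastPart z)
        (hasFDerivAt_prodMk_right (firstPart z) (lastPart z)))).sub_const (f (firstPart z))
      refine (hcomp.congr_fderiv ?_).congr_of_eventuallyEq (.of_forall fun y => ?_)
      · ext i
        simp [dotProduct_eq_add]
      · simp
  · refine ((hf.comp z (firstPartCLM k l).hasFDerivAt).add
      (hg.comp z (lastPartCLM k l).hasFDerivAt)).congr_fderiv ?_
    refine ContinuousLinearMap.ext fun v => ?_
    simp [dotProduct_eq_add w v]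

theorem hasFDerivAt_zero_dotCLM_iff {n : ℕ} {x w : Fin n → ℝ} :
    HasFDerivAt (fun _ => (0 : ℝ)) (dotCLM w) x ↔ w = 0 := by
  have dotCLM_zero : dotCLM (0 : Fin n → ℝ) = 0 := ContinuousLinearMap.ext fun v => by simp
  refine ⟨fun h => dotCLM_injective ?_, fun hw => ?_⟩
  · rw [dotCLM_zero, h.unique (hasFDerivAt_const 0 x)]
  · rw [hw, dotCLM_zero]
    exact hasFDerivAt_const 0 x

variable {K : Set (Fin k → ℝ)} {L : Set (Fin l → ℝ)} {z w : Fin (k + l) → ℝ}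

theorem hasNormal_oplusOne_iff (hK : IsNormBody K) (hL : IsNormBody L) :
    HasNormal (oplusOne K L) z w ↔
      HasNormal K (firstPart z) (firstPart w) ∧ HasNormal L (lastPart z) (lastPart w) := by
  rw [HasNormal, funext (gauge_oplusOne hK hL)]
  exact hasFDerivAt_add_parts_iff

theorem hasNormal_oplusInf_iff_left (hK : IsNormBody K) (hL : IsNormBody L)
    (hlt : gauge L (lastPart z) < gauge K (firstPart z)) :
    HasNormal (oplusInf K L) z w ↔ HasNormal K (firstPart z) (firstPart w) ∧ lastPart w = 0 := by
  have eventually_lt : ∀ᶠ x in 𝓝 z, gauge L (lastPart x) < gauge K (firstPart x) :=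
    (hL.continuous_gauge.comp (lastPartCLM k l).continuous).continuousAt.eventually_lt
      (hK.continuous_gauge.comp (firstPartCLM k l).continuous).continuousAt hlt
  have gauge_eq : gauge (oplusInf K L) =ᶠ[𝓝 z] fun x => gauge K (firstPart x) + 0 :=
    eventually_lt.mono fun x hx => by simp [gauge_oplusInf hK hL, hx.le]
  rw [HasNormal, gauge_eq.hasFDerivAt_iff, ← hasFDerivAt_zero_dotCLM_iff (x := lastPart z)]
  exact hasFDerivAt_add_parts_iff (f := gauge K) (g := fun _ => 0)

theorem hasNormal_oplusInf_iff_right (hK : IsNormBody K) (hL : IsNormBody L)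
    (hlt : gauge K (firstPart z) < gauge L (lastPart z)) :
    HasNormal (oplusInf K L) z w ↔ firstPart w = 0 ∧ HasNormal L (lastPart z) (lastPart w) := by
  have eventually_lt : ∀ᶠ x in 𝓝 z, gauge K (firstPart x) < gauge L (lastPart x) :=
    (hK.continuous_gauge.comp (firstPartCLM k l).continuous).continuousAt.eventually_lt
      (hL.continuous_gauge.comp (lastPartCLM k l).continuous).continuousAt hlt
  have gauge_eq : gauge (oplusInf K L) =ᶠ[𝓝 z] fun x => 0 + gauge L (lastPart x) :=
    eventually_lt.mono fun x hx => by simp [gauge_oplusInf hK hL, hx.le]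
  rw [HasNormal, gauge_eq.hasFDerivAt_iff, ← hasFDerivAt_zero_dotCLM_iff (x := firstPart z)]
  exact hasFDerivAt_add_parts_iff (f := fun _ => 0) (g := gauge L)

/-- A maximum of two norms has a corner where they agree: along `firstPart z` it is, up to affine
terms, a multiple of the absolute value. -/
theorem HasNormal.gauge_ne (h : HasNormal (oplusInf K L) z w) (hK : IsNormBody K)
    (hL : IsNormBody L) (hk : 0 < k) : gauge K (firstPart z) ≠ gauge L (lastPart z) := by
  intro heq
  set c := gauge K (firstPart z) with hc
  have hz : z ≠ 0 := h.point_ne_zero (hK.oplusInf hL) (Nat.add_pos_left hk l)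
  have hcpos : 0 < c := by
    rcases firstPart_ne_zero_or_lastPart_ne_zero hz with hz | hz
    · exact hK.gauge_pos _ hz
    · exact heq ▸ hL.gauge_pos _ hz
  have hdiff := (h.hasDerivAt (Fin.append (firstPart z) 0)).differentiableAt
  refine not_differentiableAt_abs_zero
    ((((hdiff.const_mul (2 / c)).sub_const 2).sub differentiableAt_fun_id).congr_of_eventuallyEq ?_)
  filter_upwards [lt_mem_nhds (show (-1 : ℝ) < 0 by simp)] with t ht
  have gauge_first : gauge K (firstPart z + t • firstPart z) = (1 + t) * c := by
    rw [hc, ← hK.gauge_smul_of_pos (by linarith), add_smul, one_smul]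
  have max_eq : max ((1 + t) * c) c = c + c * ((t + |t|) / 2) := by
    rcases le_total 0 t with ht₀ | ht₀
    · rw [abs_of_nonneg ht₀, max_eq_left (by nlinarith)]
      ring
    · rw [abs_of_nonpos ht₀, max_eq_right (by nlinarith)]
      ring
  simp only [Pi.sub_apply, gauge_oplusInf hK hL, firstPart_add, firstPart_smul, firstPart_append,
    lastPart_add, lastPart_smul, lastPart_append, smul_zero, add_zero, gauge_first, ← heq, max_eq]
  field_simp
  ring

end Sums

/-! ### Uniqueness of the reflection law -/

/-- No normal of `K` is orthogonal to a normal of `T`. -/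
def TransversalNormals {n : ℕ} (K T : Set (Fin n → ℝ)) : Prop :=
  ∀ ⦃x w y v⦄, HasNormal K x w → HasNormal T y v → w ⬝ᵥ v ≠ 0

namespace TransversalNormals

theorem symm {n : ℕ} {K T : Set (Fin n → ℝ)} (h : TransversalNormals K T) :
    TransversalNormals T K :=
  fun _ w _ v hw hv => dotProduct_comm w v ▸ h hv hw

theorem segment : TransversalNormals (Icc (-1 : Fin 1 → ℝ) 1) (Icc (-1) 1) := by
  have normal_ne_zero {x w : Fin 1 → ℝ} (h : HasNormal (Icc (-1) 1) x w) : w 0 ≠ 0 := fun hw =>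
    h.ne_zero (isNormBody_segment.gauge_pos x (h.point_ne_zero isNormBody_segment one_pos))
      (funext fun i => by rw [Subsingleton.elim i 0, hw, Pi.zero_apply])
  intro x w y v hw hv
  simpa [dotProduct] using ⟨normal_ne_zero hw, normal_ne_zero hv⟩

theorem sum {k l : ℕ} {K T : Set (Fin k → ℝ)} {L S : Set (Fin l → ℝ)} (hk : 0 < k)
    (hK : IsNormBody K) (hT : IsNormBody T) (hL : IsNormBody L) (hS : IsNormBody S)
    (hKT : TransversalNormals K T) (hLS : TransversalNormals L S) :
    TransversalNormals (oplusOne K L) (oplusInf T S) := by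
  intro x w y v hw hv
  obtain ⟨hw₁, hw₂⟩ := (hasNormal_oplusOne_iff hK hL).1 hw
  rw [dotProduct_eq_add]
  rcases lt_or_gt_of_ne (hv.gauge_ne hT hS hk) with hlt | hlt
  · obtain ⟨hv₁, hv₂⟩ := (hasNormal_oplusInf_iff_right hT hS hlt).1 hv
    simpa [hv₁] using hLS hw₂ hv₂
  · obtain ⟨hv₁, hv₂⟩ := (hasNormal_oplusInf_iff_left hT hS hlt).1 hv
    simpa [hv₂] using hKT hw₁ hv₁

end TransversalNormals

theorem IsHannerPair.transversalNormals {n : ℕ} {K T : Set (Fin n → ℝ)}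
    (h : IsHannerPair n K T) : TransversalNormals K T := by
  induction h with
  | segment => exact .segment
  | symm _ ih => exact ih.symm
  | sum h₁ h₂ ih₁ ih₂ =>
    exact .sum h₁.dim_pos h₁.isNormBody.1 h₁.isNormBody.2 h₂.isNormBody.1 h₂.isNormBody.2 ih₁ ih₂

section Chord

variable {n : ℕ} {K T : Set (Fin n → ℝ)}

theorem HasNormal.gauge_chord_lt {x w d : Fin n → ℝ} (h : HasNormal K x w) (hK : IsNormBody K)
    (hx : gauge K x = 1) (hd : w ⬝ᵥ d ≠ 0) {a s : ℝ} (ha : gauge K (x + a • d) ≤ 1) (hs : 0 < s)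
    (hsa : s < a) : gauge K (x + s • d) < 1 := by
  have convexOn_line : ConvexOn ℝ univ fun t : ℝ => gauge K (x + t • d) := by
    refine (hK.convexOn_gauge.comp_affineMap (AffineMap.lineMap x (x + d))).congr fun t _ => ?_
    simp [AffineMap.lineMap_apply, add_comm]
  have slope_neg : w ⬝ᵥ d < 0 := by
    refine hd.lt_of_le ?_
    have := h.dotProduct_le hK (x + a • d)
    rw [dotProduct_add, h.dotProduct_self, hx, dotProduct_smul, smul_eq_mul] at this
    exact nonpos_of_mul_nonpos_right (by linarith) (hs.trans hsa)
  obtain ⟨t, ht, ht₀, hts⟩ := (((h.hasDerivAt d).tendsto_slope_zero_right.eventually_lt_const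
    slope_neg).and (Ioo_mem_nhdsGT hs)).exists
  have gauge_t_lt : gauge K (x + t • d) < 1 := by
    simpa [hx, inv_mul_lt_iff₀ ht₀] using ht
  by_contra! hge
  exact ((convexOn_line.lt_right_of_left_lt (mem_univ t) (mem_univ a)
    (by rw [openSegment_eq_Ioo (hts.trans hsa)]; exact ⟨hts, hsa⟩)
    (gauge_t_lt.trans_le hge)).trans_le ha).not_ge hge

theorem HasNormal.chord_unique {x w d : Fin n → ℝ} (h : HasNormal K x w) (hK : IsNormBody K)
    (hx : gauge K x = 1) (hd : w ⬝ᵥ d ≠ 0) {a b : ℝ} (ha : 0 < a) (hb : 0 < b)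
    (hga : gauge K (x + a • d) = 1) (hgb : gauge K (x + b • d) = 1) : a = b := by
  rcases lt_trichotomy a b with hab | hab | hab
  · exact absurd hga (h.gauge_chord_lt hK hx hd hgb.le ha hab).ne
  · exact hab
  · exact absurd hgb (h.gauge_chord_lt hK hx hd hga.le hb hab).ne

theorem IsSmoothBoundaryPoint.chord_unique {x y y' d : Fin n → ℝ} (hK : IsNormBody K)
    (hx : IsSmoothBoundaryPoint K x) (hy : IsSmoothBoundaryPoint K y)
    (hy' : IsSmoothBoundaryPoint K y') (hd : outerNormal K x ⬝ᵥ d ≠ 0)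
    (h : ∃ a : ℝ, 0 < a ∧ y - x = a • d) (h' : ∃ a : ℝ, 0 < a ∧ y' - x = a • d) : y = y' := by
  obtain ⟨a, ha, hya⟩ := h
  obtain ⟨b, hb, hyb⟩ := h'
  rw [sub_eq_iff_eq_add'] at hya hyb
  rw [hya, hyb, hx.hasNormal.chord_unique hK (hx.gauge_eq_one hK) hd ha hb
    (hya ▸ hy.gauge_eq_one hK) (hyb ▸ hy'.gauge_eq_one hK)]

theorem BilliardStep.unique {q p q₁ p₁ q₂ p₂ : Fin n → ℝ} (hK : IsNormBody K)
    (hT : IsNormBody T) (hKT : TransversalNormals K T) (h₁ : BilliardStep K T q p q₁ p₁)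
    (h₂ : BilliardStep K T q p q₂ p₂) : q₁ = q₂ ∧ p₁ = p₂ := by
  have hp : p₁ = p₂ := by
    refine h₁.smooth_p.chord_unique hT h₁.smooth_p' h₂.smooth_p' (d := -outerNormal K q) ?_
      (by simpa only [smul_neg] using h₁.reflect) (by simpa only [smul_neg] using h₂.reflect)
    simpa using hKT.symm h₁.smooth_p.hasNormal h₁.smooth_q.hasNormal
  subst hp
  exact ⟨h₁.smooth_q.chord_unique hK h₁.smooth_q' h₂.smooth_q'
    (hKT h₁.smooth_q.hasNormal h₁.smooth_p'.hasNormal) h₁.move h₂.move, rfl⟩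

theorem IsClassicalTrajectory.forward_unique {m : ℕ} {q p : ℤ → Fin n → ℝ} (hK : IsNormBody K)
    (hT : IsNormBody T) (hKT : TransversalNormals K T) (h : IsClassicalTrajectory K T m q p)
    {i₀ : ℤ} {q' p' : ℕ → Fin n → ℝ} (hq : q' 0 = q i₀) (hp : p' 0 = p i₀)
    (hstep : ∀ i, BilliardStep K T (q' i) (p' i) (q' (i + 1)) (p' (i + 1))) (i : ℕ) :
    q' i = q (i + i₀) ∧ p' i = p (i + i₀) := by
  induction i with
  | zero => simp [hq, hp]
  | succ i ih =>
    have hnext := hstep i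
    rw [ih.1, ih.2] at hnext
    rw [Nat.cast_succ, add_right_comm]
    exact BilliardStep.unique hK hT hKT hnext (h.step _)

end Chord

/-! ### Sequences indexed by the integers -/

theorem eq_of_periodic_one {α : Type*} {f : ℤ → α} (h : Function.Periodic f 1) (i j : ℤ) :
    f i = f j := by
  simpa using h.int_mul_eq i |>.trans (h.int_mul_eq j).symm

theorem exists_antidifference {α : Type*} [AddCommGroup α] (a : ℤ → α) (i₀ : ℤ) :
    ∃ σ : ℤ → α, σ i₀ = 0 ∧ ∀ i, σ (i + 1) = σ i + a i := by
  refine ⟨fun i => ∑ j ∈ Finset.Ico i₀ i, a j - ∑ j ∈ Finset.Ico i i₀, a j, by simp, fun i => ?_⟩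
  beta_reduce
  rcases le_or_gt i₀ i with hi | hi
  · rw [← Finset.insert_Ico_right_eq_Ico_add_one hi, Finset.sum_insert Finset.right_notMem_Ico,
      Finset.Ico_eq_empty_of_le hi, Finset.Ico_eq_empty_of_le (by lia : i₀ ≤ i + 1)]
    simp only [Finset.sum_empty, sub_zero, add_comm]
  · rw [← Finset.insert_Ico_add_one_left_eq_Ico hi, Finset.sum_insert (by simp),
      Finset.Ico_eq_empty_of_le hi.le, Finset.Ico_eq_empty_of_le (Int.add_one_le_of_lt hi)]
    simp only [Finset.sum_empty, zero_sub, neg_add_rev, neg_add_cancel_right]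

theorem exists_strictMono_range_eq {α : Type*} [LinearOrder α] (S : Set α) (hne : S.Nonempty)
    (hfin : ∀ a b, (S ∩ Icc a b).Finite) (hmax : ∀ s ∈ S, ∃ s' ∈ S, s < s')
    (hmin : ∀ s ∈ S, ∃ s' ∈ S, s' < s) : ∃ e : ℤ → α, StrictMono e ∧ range e = S := by
  classical
  have finite_Icc (a b : S) : (Icc a b).Finite := by
    refine .of_finite_image ((hfin a b).subset ?_) Subtype.val_injective.injOn
    rintro _ ⟨x, hx, rfl⟩
    exact ⟨x.2, hx⟩
  let _ : LocallyFiniteOrder S := .ofFiniteIcc finite_Icc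
  let _ : SuccOrder S := LinearLocallyFiniteOrder.succOrder S
  let _ : PredOrder S := LinearLocallyFiniteOrder.predOrder S
  have : NoMaxOrder S := ⟨fun a => let ⟨b, hb, h⟩ := hmax a a.2; ⟨⟨b, hb⟩, h⟩⟩
  have : NoMinOrder S := ⟨fun a => let ⟨b, hb, h⟩ := hmin a a.2; ⟨⟨b, hb⟩, h⟩⟩
  have : Nonempty S := hne.to_subtype
  let e : S ≃o ℤ := orderIsoIntOfLinearSuccPredArch
  refine ⟨fun i => e.symm i, fun i j hij => e.symm.strictMono hij, ?_⟩
  exact (e.symm.surjective.range_comp Subtype.val).trans Subtype.range_coe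

theorem exists_add_eq_of_range_invariant {α : Type*} [AddCommGroup α] [LinearOrder α]
    [IsOrderedAddMonoid α] {e : ℤ → α} (he : StrictMono e) {c : α}
    (h : ∀ x, x ∈ range e ↔ x + c ∈ range e) : ∃ M : ℤ, ∀ i, e (i + M) = e i + c := by
  choose φ hφ using fun i => (h (e i)).1 ⟨i, rfl⟩
  have φ_mono : StrictMono φ := fun i j hij => he.lt_iff_lt.1 (by simpa [hφ] using he hij)
  have φ_surjective (j : ℤ) : ∃ i, φ i = j := by
    obtain ⟨i, hi⟩ := (h (e j - c)).2 (by simp)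
    exact ⟨i, he.injective (by rw [hφ, hi, sub_add_cancel])⟩
  have φ_succ (i : ℤ) : φ (i + 1) = φ i + 1 := by
    obtain ⟨j, hj⟩ := φ_surjective (φ i + 1)
    have : i < j := φ_mono.lt_iff_lt.1 (by lia)
    have : φ (i + 1) ≤ φ j := φ_mono.monotone (by lia)
    have := φ_mono (lt_add_one i)
    lia
  have φ_sub_const (i : ℤ) : φ i - i = φ 0 - 0 :=
    eq_of_periodic_one (f := fun i => φ i - i) (fun i => by simp only [φ_succ]; ring) i 0
  exact ⟨φ 0, fun i => by rw [← hφ, show φ i = i + φ 0 by linarith [φ_sub_const i]]⟩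

theorem eq_of_mem_Ico_succ {α : Type*} [LinearOrder α] {σ : ℤ → α} (hσ : StrictMono σ) {x : α}
    {i j : ℤ} (hi : x ∈ Ico (σ i) (σ (i + 1))) (hj : x ∈ Ico (σ j) (σ (j + 1))) : i = j := by
  have := hσ.lt_iff_lt.1 (hi.1.trans_lt hj.2)
  have := hσ.lt_iff_lt.1 (hj.1.trans_lt hi.2)
  lia

/-- The times `σ i` of a sequence of events that repeats itself: `m` consecutive events take the
time `P > 0`. -/
structure IsClock (m : ℤ) (P : ℝ) (σ : ℤ → ℝ) : Prop where
  pos : 0 < P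
  strictMono : StrictMono σ
  add_period : ∀ i, σ (i + m) = σ i + P

namespace IsClock

variable {m m₁ m₂ : ℤ} {P : ℝ} {σ σ₁ σ₂ : ℤ → ℝ}

theorem pos_steps (h : IsClock m P σ) : 0 < m := by
  have := h.add_period 0
  rw [zero_add] at this
  exact h.strictMono.lt_iff_lt.1 (by linarith [h.pos])

theorem add_const (h : IsClock m P σ) (c : ℝ) : IsClock m P fun i => σ i + c :=
  ⟨h.pos, h.strictMono.add_const c, fun i => by simp only [h.add_period, add_right_comm]⟩

theorem add_int_mul (h : IsClock m P σ) (n i : ℤ) : σ (i + n * m) = σ i + n * P := by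
  simpa using AddConstMapClass.map_add_zsmul (⟨σ, h.add_period⟩ : AddConstMap ℤ ℝ m P) i n

theorem exists_le (h : IsClock m P σ) (x : ℝ) : ∃ i, σ i ≤ x := by
  obtain ⟨n, hn⟩ := exists_int_lt ((x - σ 0) / P)
  refine ⟨0 + n * m, ?_⟩
  have := (lt_div_iff₀ h.pos).1 hn
  linarith [h.add_int_mul n 0]

theorem exists_gt (h : IsClock m P σ) (x : ℝ) : ∃ i, x < σ i := by
  obtain ⟨n, hn⟩ := exists_int_gt ((x - σ 0) / P)
  refine ⟨0 + n * m, ?_⟩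
  have := (div_lt_iff₀ h.pos).1 hn
  linarith [h.add_int_mul n 0]

theorem exists_mem_Ico (h : IsClock m P σ) (x : ℝ) : ∃ i, x ∈ Ico (σ i) (σ (i + 1)) := by
  obtain ⟨b, hb⟩ := h.exists_gt x
  obtain ⟨i, hi, hmax⟩ := Int.exists_greatest_of_bdd (P := fun j => σ j ≤ x)
    ⟨b, fun j hj => (h.strictMono.lt_iff_lt.1 (hj.trans_lt hb)).le⟩ (h.exists_le x)
  exact ⟨i, hi, not_le.1 fun hle => (lt_add_one i).not_ge (hmax _ hle)⟩

theorem mem_range_add_iff (h : IsClock m P σ) (x : ℝ) : x + P ∈ range σ ↔ x ∈ range σ := by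
  constructor
  · rintro ⟨i, hi⟩
    exact ⟨i - m, by linarith [h.add_period (i - m), congrArg σ (sub_add_cancel i m)]⟩
  · rintro ⟨i, rfl⟩
    exact ⟨i + m, h.add_period i⟩

theorem finite_preimage_Icc (h : IsClock m P σ) (a b : ℝ) : (σ ⁻¹' Icc a b).Finite := by
  obtain ⟨i, hi⟩ := h.exists_le a
  obtain ⟨j, hj⟩ := h.exists_gt b
  exact (finite_Icc i j).subset fun x hx => ⟨h.strictMono.le_iff_le.1 (hi.trans hx.1),
    h.strictMono.le_iff_le.1 (hx.2.trans hj.le)⟩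

theorem finite_coincidences (h₁ : IsClock m₁ P σ₁) (h₂ : IsClock m₂ P σ₂) (a b : ℝ) :
    {s ∈ Icc a b | ∃ i j, σ₁ i = σ₂ j + s}.Finite := by
  refine ((finite_Ico 0 m₂).biUnion fun j _ =>
    (h₁.finite_preimage_Icc (σ₂ j + a) (σ₂ j + b)).image fun i => σ₁ i - σ₂ j).subset ?_
  rintro s ⟨hs, i, j, hij⟩
  have reduce₁ := h₁.add_int_mul (-(j / m₂)) i
  have reduce₂ := h₂.add_int_mul (j / m₂) (j % m₂)
  rw [Int.emod_add_ediv_mul] at reduce₂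
  push_cast at reduce₁
  refine mem_iUnion₂.2 ⟨j % m₂, ⟨Int.emod_nonneg _ h₂.pos_steps.ne',
    Int.emod_lt_of_pos _ h₂.pos_steps⟩, i + -(j / m₂) * m₁, ⟨?_, ?_⟩, ?_⟩ <;>
  linarith [hs.1, hs.2]

theorem finite_coincidences_delay (h₁ : IsClock m₁ P σ₁) (h₂ : IsClock m₂ P σ₂) {c : ℝ}
    (hc : c ≠ 0) : {β ∈ Icc (0 : ℝ) 1 | ∃ i j, σ₁ i = σ₂ j + (1 - β) * c}.Finite := by
  have delay_injective : Function.Injective fun β : ℝ => (1 - β) * c :=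
    (mul_left_injective₀ hc).comp sub_right_injective
  refine ((h₁.finite_coincidences h₂ (-|c|) |c|).preimage delay_injective.injOn).subset ?_
  rintro β ⟨hβ, hcoincide⟩
  refine ⟨abs_le.1 ?_, hcoincide⟩
  rw [abs_mul, abs_of_nonneg (sub_nonneg.2 hβ.2)]
  exact mul_le_of_le_one_left (abs_nonneg c) (sub_le_self 1 hβ.1)

end IsClock

theorem not_periodic_comp {α : Type*} {f : ℤ → α} {u : ℤ → ℤ} {N m : ℕ}
    (hf : ∀ j, f (j + 1) ≠ f j) (hper : ∀ d : ℕ, 0 < d → d < m → ¬Function.Periodic f d)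
    (hu : Function.Surjective u) (hstep : ∀ i, u (i + 1) = u i ∨ u (i + 1) = u i + 1)
    (hm : 0 < m) (huN : ∀ i, u (i + N) = u i + m) {d : ℕ} (hd : 0 < d) (hdN : d < N) :
    ¬Function.Periodic (f ∘ u) d := by
  intro hcomp
  have increments_eq (i : ℤ) : u (i + 1 + d) - u (i + 1) = u (i + d) - u i := by
    have hi : f (u (i + d)) = f (u i) := hcomp i
    have hi' : f (u (i + d + 1)) = f (u (i + 1)) := add_right_comm i d 1 ▸ hcomp (i + 1)
    rw [add_right_comm]
    rcases hstep i with h | h <;> rcases hstep (i + d) with h' | h' <;> rw [h, h'] at hi'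
    · rw [h, h']
    · exact absurd (hi'.trans hi.symm) (hf _)
    · exact absurd (hi'.symm.trans hi) (hf _)
    · lia
  obtain ⟨c, hc⟩ : ∃ c, ∀ i, u (i + d) = u i + c := ⟨u (0 + d) - u 0, fun i => by
    linarith [eq_of_periodic_one (f := fun i => u (i + d) - u i) increments_eq i 0]⟩
  have rotation : d * m = N * c := by
    have hN := AddConstMapClass.map_add_zsmul (⟨u, huN⟩ : AddConstMap ℤ ℤ N m) 0 d
    have hd := AddConstMapClass.map_add_zsmul (⟨u, hc⟩ : AddConstMap ℤ ℤ d c) 0 N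
    simp only [AddConstMap.coe_mk, smul_eq_mul] at hN hd
    rw [mul_comm (N : ℤ) d] at hd
    linarith
  have c_pos : 0 < c := by
    refine pos_of_mul_pos_right (rotation ▸ ?_ : 0 < (N : ℤ) * c) N.cast_nonneg
    positivity
  have c_lt : c < m := by
    refine lt_of_mul_lt_mul_left (rotation ▸ ?_ : (N : ℤ) * c < N * m) N.cast_nonneg
    gcongr
  lift c to ℕ using c_pos.le
  refine hper c (mod_cast c_pos) (mod_cast c_lt) fun j => ?_
  obtain ⟨i, rfl⟩ := hu j
  rw [← hc]
  exact hcomp i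

/-! ### Merging two sequences of times -/

/-- The strictly increasing sequence `t` enumerates the times of the two disjoint sequences `σ₁` and
`σ₂`; the last of them up to the time `t i` are `σ₁ (u i)` and `σ₂ (v i)`. -/
structure IsMerge (σ₁ σ₂ t : ℤ → ℝ) (u v : ℤ → ℤ) : Prop where
  strictMono_left : StrictMono σ₁
  strictMono_right : StrictMono σ₂
  strictMono : StrictMono t
  ne : ∀ i j, σ₁ i ≠ σ₂ j
  range_eq : range t = range σ₁ ∪ range σ₂
  mem_left : ∀ i, t i ∈ Ico (σ₁ (u i)) (σ₁ (u i + 1))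
  mem_right : ∀ i, t i ∈ Ico (σ₂ (v i)) (σ₂ (v i + 1))

/-- In a merge of `σ₁` and `σ₂`, the time `t (i + 1)` is the next time of `σ₁`, while `σ₂` is
strictly between two of its times. -/
structure IsLeftEvent (σ₁ σ₂ t : ℤ → ℝ) (u v : ℤ → ℤ) (i : ℤ) : Prop where
  left_succ : u (i + 1) = u i + 1
  right_succ : v (i + 1) = v i
  time_eq : t (i + 1) = σ₁ (u (i + 1))
  lt_time : σ₂ (v (i + 1)) < t (i + 1)

namespace IsMerge

variable {m₁ m₂ : ℤ} {P : ℝ} {σ₁ σ₂ t : ℤ → ℝ} {u v : ℤ → ℤ}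

theorem symm (h : IsMerge σ₁ σ₂ t u v) : IsMerge σ₂ σ₁ t v u :=
  ⟨h.strictMono_right, h.strictMono_left, h.strictMono, fun i j => (h.ne j i).symm,
    h.range_eq.trans (union_comm _ _), h.mem_right, h.mem_left⟩

theorem left_eq (h : IsMerge σ₁ σ₂ t u v) {i j : ℤ} (hj : t i ∈ Ico (σ₁ j) (σ₁ (j + 1))) :
    u i = j :=
  eq_of_mem_Ico_succ h.strictMono_left (h.mem_left i) hj

theorem left_eq_of_time_eq (h : IsMerge σ₁ σ₂ t u v) {i j : ℤ} (hj : t i = σ₁ j) : u i = j :=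
  h.left_eq ⟨hj.ge, hj ▸ h.strictMono_left (lt_add_one j)⟩

theorem exists_left_eq (h : IsMerge σ₁ σ₂ t u v) (j : ℤ) : ∃ i, u i = j ∧ t i = σ₁ j := by
  obtain ⟨i, hi⟩ : σ₁ j ∈ range t := h.range_eq ▸ .inl ⟨j, rfl⟩
  exact ⟨i, h.left_eq_of_time_eq hi, hi⟩

theorem surjective_left (h : IsMerge σ₁ σ₂ t u v) : Function.Surjective u :=
  fun j => (h.exists_left_eq j).imp fun _ => And.left

theorem time_succ_le (h : IsMerge σ₁ σ₂ t u v) (i : ℤ) : t (i + 1) ≤ σ₁ (u i + 1) := by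
  obtain ⟨j, -, hj⟩ := h.exists_left_eq (u i + 1)
  rw [← hj]
  exact h.strictMono.monotone (h.strictMono.lt_iff_lt.1 (hj ▸ (h.mem_left i).2))

theorem isLeftEvent (h : IsMerge σ₁ σ₂ t u v) {i j : ℤ} (hj : t (i + 1) = σ₁ j) :
    IsLeftEvent σ₁ σ₂ t u v i := by
  have time_lt : t i < t (i + 1) := h.strictMono (lt_add_one i)
  have left_next : u (i + 1) = j := h.left_eq_of_time_eq hj
  have left_le : j ≤ u i + 1 := h.strictMono_left.le_iff_le.1 (hj ▸ h.time_succ_le i)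
  have left_lt : u i < j :=
    h.strictMono_left.lt_iff_lt.1 ((h.mem_left i).1.trans_lt (hj ▸ time_lt))
  exact ⟨by lia, h.symm.left_eq ⟨(h.mem_right i).1.trans time_lt.le,
    (h.symm.time_succ_le i).lt_of_ne (hj ▸ h.ne _ _)⟩, left_next ▸ hj,
    (h.mem_right _).1.lt_of_ne (hj ▸ (h.ne _ _).symm)⟩

theorem isLeftEvent_or (h : IsMerge σ₁ σ₂ t u v) (i : ℤ) :
    IsLeftEvent σ₁ σ₂ t u v i ∨ IsLeftEvent σ₂ σ₁ t v u i := by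
  rcases (h.range_eq ▸ mem_range_self (i + 1) : t (i + 1) ∈ range σ₁ ∪ range σ₂) with
    ⟨j, hj⟩ | ⟨j, hj⟩
  · exact .inl (h.isLeftEvent hj.symm)
  · exact .inr (h.symm.isLeftEvent hj.symm)

theorem left_succ_eq (h : IsMerge σ₁ σ₂ t u v) (i : ℤ) : u (i + 1) = u i ∨ u (i + 1) = u i + 1 :=
  (h.isLeftEvent_or i).symm.imp IsLeftEvent.right_succ IsLeftEvent.left_succ

theorem monotone_left (h : IsMerge σ₁ σ₂ t u v) : Monotone u :=
  monotone_int_of_le_succ fun i => by rcases h.left_succ_eq i with hi | hi <;> lia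

theorem left_add_period (h : IsMerge σ₁ σ₂ t u v) (h₁ : IsClock m₁ P σ₁) {N : ℤ}
    (ht : ∀ i, t (i + N) = t i + P) (i : ℤ) : u (i + N) = u i + m₁ := by
  refine h.left_eq ?_
  rw [ht, add_right_comm, h₁.add_period, h₁.add_period]
  exact ⟨by linarith [(h.mem_left i).1], by linarith [(h.mem_left i).2]⟩

theorem isClock (h : IsMerge σ₁ σ₂ t u v) (h₁ : IsClock m₁ P σ₁) (h₂ : IsClock m₂ P σ₂) :
    IsClock (m₁ + m₂) P t := by
  obtain ⟨N, hN⟩ := exists_add_eq_of_range_invariant h.strictMono (c := P) fun x => by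
    simp only [h.range_eq, mem_union, h₁.mem_range_add_iff, h₂.mem_range_add_iff]
  have count_events : u (0 + N) + v (0 + N) - (0 + N) = u 0 + v 0 - 0 :=
    eq_of_periodic_one (f := fun i => u i + v i - i) (fun i => by
      rcases h.isLeftEvent_or i with hi | hi <;>
        simp only [hi.left_succ, hi.right_succ] <;> ring) _ _
  rw [h.left_add_period h₁ hN, h.symm.left_add_period h₂ hN] at count_events
  obtain rfl : N = m₁ + m₂ := by lia
  exact ⟨h₁.pos, h.strictMono, hN⟩

end IsMerge

theorem exists_isMerge {m₁ m₂ : ℤ} {P₁ P₂ : ℝ} {σ₁ σ₂ : ℤ → ℝ} (h₁ : IsClock m₁ P₁ σ₁)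
    (h₂ : IsClock m₂ P₂ σ₂) (hne : ∀ i j, σ₁ i ≠ σ₂ j) :
    ∃ t u v, IsMerge σ₁ σ₂ t u v ∧ t 1 = σ₂ 1 := by
  obtain ⟨e, he, hr⟩ := exists_strictMono_range_eq (range σ₁ ∪ range σ₂) ⟨σ₁ 0, .inl ⟨0, rfl⟩⟩
    (fun a b => by
      simp only [union_inter_distrib_right, ← image_preimage_eq_range_inter]
      exact ((h₁.finite_preimage_Icc a b).image σ₁).union ((h₂.finite_preimage_Icc a b).image σ₂))
    (by
      rintro _ (⟨j, rfl⟩ | ⟨j, rfl⟩)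
      · exact ⟨_, .inl ⟨j + 1, rfl⟩, h₁.strictMono (lt_add_one j)⟩
      · exact ⟨_, .inr ⟨j + 1, rfl⟩, h₂.strictMono (lt_add_one j)⟩)
    (by
      rintro _ (⟨j, rfl⟩ | ⟨j, rfl⟩)
      · exact ⟨_, .inl ⟨j - 1, rfl⟩, h₁.strictMono (sub_one_lt j)⟩
      · exact ⟨_, .inr ⟨j - 1, rfl⟩, h₂.strictMono (sub_one_lt j)⟩)
  obtain ⟨i₀, hi₀⟩ : σ₂ 1 ∈ range e := hr ▸ .inr ⟨1, rfl⟩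
  choose u hu using fun i => h₁.exists_mem_Ico (e (i + (i₀ - 1)))
  choose v hv using fun i => h₂.exists_mem_Ico (e (i + (i₀ - 1)))
  refine ⟨fun i => e (i + (i₀ - 1)), u, v, ⟨h₁.strictMono, h₂.strictMono, fun i j hij =>
    he (by lia), hne, ?_, hu, hv⟩, by simpa using hi₀⟩
  exact ((Equiv.addRight (i₀ - 1)).surjective.range_comp e).trans hr

/-! ### Timed trajectories and their antipodal symmetry -/

/-- A closed billiard trajectory in `K × T` with `m` bounces, together with the times `σ i` at which
the momentum `p i` is reached when the momenta move with velocity `-outerNormal K (q i)`. -/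
structure IsTimedTrajectory {n : ℕ} (K T : Set (Fin n → ℝ)) (m : ℤ) (q p : ℤ → Fin n → ℝ)
    (σ : ℤ → ℝ) : Prop where
  pos : 0 < m
  periodic_q : Function.Periodic q m
  periodic_p : Function.Periodic p m
  smooth_q : ∀ i, IsSmoothBoundaryPoint K (q i)
  smooth_p : ∀ i, IsSmoothBoundaryPoint T (p i)
  strictMono : StrictMono σ
  reflect : ∀ i, p (i + 1) = p i - (σ (i + 1) - σ i) • outerNormal K (q i)
  move : ∀ i, ∃ b : ℝ, 0 < b ∧ q (i + 1) = q i + b • outerNormal T (p (i + 1))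

/-- Every closed trajectory in `K × T` arrives at the antipodal state after the momentum has
travelled for time `2`. -/
def IsAntipodal {n : ℕ} (K T : Set (Fin n → ℝ)) : Prop :=
  ∀ ⦃m q p σ⦄, IsTimedTrajectory K T m q p σ →
    ∃ M, ∀ i, q (i + M) = -q i ∧ p (i + M) = -p i ∧ σ (i + M) = σ i + 2

theorem IsSmoothBoundaryPoint.outerNormal_neg {n : ℕ} {K : Set (Fin n → ℝ)} {x : Fin n → ℝ}
    (h : IsSmoothBoundaryPoint K x) (hK : IsNormBody K) : outerNormal K (-x) = -outerNormal K x :=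
  (h.hasNormal.neg hK).outerNormal_eq

theorem IsSmoothBoundaryPoint.outerNormal_dotProduct_self {n : ℕ} {K : Set (Fin n → ℝ)}
    {x : Fin n → ℝ} (h : IsSmoothBoundaryPoint K x) (hK : IsNormBody K) :
    outerNormal K x ⬝ᵥ x = 1 :=
  h.hasNormal.dotProduct_self.trans (h.gauge_eq_one hK)

theorem IsSmoothBoundaryPoint.outerNormal_ne_zero {n : ℕ} {K : Set (Fin n → ℝ)} {x : Fin n → ℝ}
    (h : IsSmoothBoundaryPoint K x) (hK : IsNormBody K) : outerNormal K x ≠ 0 :=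
  h.hasNormal.ne_zero (h.gauge_eq_one hK ▸ one_pos)

theorem IsTimedTrajectory.dual {n : ℕ} {K T : Set (Fin n → ℝ)} {m : ℤ} {q p : ℤ → Fin n → ℝ}
    {σ : ℤ → ℝ} (hK : IsNormBody K) (hT : IsNormBody T) (h : IsTimedTrajectory K T m q p σ) :
    IsTimedTrajectory T K m (fun i => p (i + 1)) (fun i => -q i) fun i => σ i + p i ⬝ᵥ q i := by
  have step (i : ℤ) : ∃ b : ℝ, 0 < b ∧ q (i + 1) = q i + b • outerNormal T (p (i + 1)) ∧
      σ (i + 1) + p (i + 1) ⬝ᵥ q (i + 1) = σ i + p i ⬝ᵥ q i + b := by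
    obtain ⟨b, hb, hq⟩ := h.move i
    refine ⟨b, hb, hq, ?_⟩
    rw [hq, dotProduct_add, dotProduct_smul, dotProduct_comm _ (outerNormal T _),
      (h.smooth_p _).outerNormal_dotProduct_self hT, h.reflect i, sub_dotProduct, smul_dotProduct,
      (h.smooth_q i).outerNormal_dotProduct_self hK]
    simp only [smul_eq_mul]
    ring
  refine ⟨h.pos, fun i => ?_, fun i => ?_, fun i => h.smooth_p _, fun i => (h.smooth_q i).neg hK,
    strictMono_int_of_lt_succ fun i => ?_, fun i => ?_, fun i => ?_⟩
  · rw [add_right_comm, h.periodic_p]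
  · rw [h.periodic_q]
  · obtain ⟨b, hb, -, hσ⟩ := step i
    linarith
  · obtain ⟨b, -, hq, hσ⟩ := step i
    rw [hσ, hq, add_sub_cancel_left, neg_add, sub_eq_add_neg]
  · refine ⟨_, sub_pos.2 (h.strictMono (lt_add_one (i + 1))), ?_⟩
    rw [(h.smooth_q _).outerNormal_neg hK, h.reflect (i + 1), smul_neg, sub_eq_add_neg]

namespace IsAntipodal

theorem symm {n : ℕ} {K T : Set (Fin n → ℝ)} (hK : IsNormBody K) (hT : IsNormBody T)
    (h : IsAntipodal K T) : IsAntipodal T K := by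
  intro m q p σ ht
  obtain ⟨M, hM⟩ := h (ht.dual hT hK)
  have hq (i : ℤ) : q (i + M) = -q i := by simpa [neg_eq_iff_eq_neg] using (hM i).2.1
  have hp (i : ℤ) : p (i + M) = -p i := by
    simpa [add_right_comm _ M 1] using (hM (i - 1)).1
  have hσ (i : ℤ) : σ (i + M) = σ i + 2 := by
    have := (hM i).2.2
    rw [hq, hp, dotProduct_neg, neg_dotProduct, neg_neg] at this
    linarith
  exact ⟨M, fun i => ⟨hq i, hp i, hσ i⟩⟩

theorem segment : IsAntipodal (Icc (-1 : Fin 1 → ℝ) 1) (Icc (-1) 1) := by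
  have apply_eq {x : Fin 1 → ℝ} (hx : IsSmoothBoundaryPoint (Icc (-1) 1) x) :
      x 0 = 1 ∨ x 0 = -1 :=
    eq_or_eq_neg_of_abs_eq (gauge_segment x ▸ hx.gauge_eq_one isNormBody_segment)
  have normal_eq {x : Fin 1 → ℝ} (hx : IsSmoothBoundaryPoint (Icc (-1) 1) x) :
      outerNormal (Icc (-1) 1) x = x := by
    have := hx.outerNormal_dotProduct_self isNormBody_segment
    ext i
    rw [Subsingleton.elim i 0]
    rcases apply_eq hx with h | h <;> simp [dotProduct, h] at this ⊢ <;> linarith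
  have reflect_eq {x y y' : Fin 1 → ℝ} {a : ℝ} (hx : IsSmoothBoundaryPoint (Icc (-1) 1) x)
      (hy : IsSmoothBoundaryPoint (Icc (-1) 1) y) (hy' : IsSmoothBoundaryPoint (Icc (-1) 1) y')
      (ha : 0 < a) (h : y' = y - a • x) : y = x ∧ y' = -x ∧ a = 2 := by
    simp only [funext_iff, Fin.forall_fin_one, Pi.sub_apply, Pi.smul_apply, Pi.neg_apply,
      smul_eq_mul] at h ⊢
    rcases apply_eq hx with h₁ | h₁ <;> rcases apply_eq hy with h₂ | h₂ <;>
      rcases apply_eq hy' with h₃ | h₃ <;> simp only [h₁, h₂, h₃] at h ⊢ <;> norm_num <;> linarith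
  intro m q p σ h
  refine ⟨1, fun i => ?_⟩
  obtain ⟨hp, hp', hσ⟩ := reflect_eq (h.smooth_q i) (h.smooth_p i) (h.smooth_p (i + 1))
    (sub_pos.2 (h.strictMono (lt_add_one i))) (normal_eq (h.smooth_q i) ▸ h.reflect i)
  obtain ⟨b, hb, hq⟩ := h.move i
  rw [normal_eq (h.smooth_p _)] at hq
  obtain ⟨-, hq', -⟩ := reflect_eq ((h.smooth_p (i + 1)).neg isNormBody_segment) (h.smooth_q i)
    (h.smooth_q (i + 1)) hb (by rw [hq, smul_neg, sub_neg_eq_add])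
  exact ⟨by rw [hq', neg_neg, hp'], by rw [hp', hp], by linarith⟩

end IsAntipodal

/-- A component `x, y` of a closed trajectory in a sum of two bodies, with `x` rescaled to the
boundary of `K`: the component `y` moves all the time, while `x` moves only at the indices in
`Z`. -/
structure IsComponent {n : ℕ} (K T : Set (Fin n → ℝ)) (m : ℤ) (Z : Set ℤ) (x y : ℤ → Fin n → ℝ)
    (σ : ℤ → ℝ) : Prop where
  pos : 0 < m
  periodic_x : Function.Periodic x m
  periodic_y : Function.Periodic y m
  periodic_mem : Function.Periodic (· ∈ Z) m
  smooth_x : ∀ i, IsSmoothBoundaryPoint K (x i)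
  smooth_y : ∀ i ∈ Z, IsSmoothBoundaryPoint T (y i)
  strictMono : StrictMono σ
  reflect : ∀ i, y (i + 1) = y i - (σ (i + 1) - σ i) • outerNormal K (x i)
  stay : ∀ i, i + 1 ∉ Z → x (i + 1) = x i
  move : ∀ i, i + 1 ∈ Z → ∃ b : ℝ, 0 < b ∧ x (i + 1) = x i + b • outerNormal T (y (i + 1))

namespace IsComponent

variable {n k l : ℕ} {K T : Set (Fin n → ℝ)} {m : ℤ} {Z : Set ℤ} {x y : ℤ → Fin n → ℝ} {σ : ℤ → ℝ}

theorem eq_of_forall_notMem (h : IsComponent K T m Z x y σ) {i j : ℤ} (hij : i ≤ j)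
    (hZ : ∀ a ∈ Ioc i j, a ∉ Z) :
    x j = x i ∧ y j = y i - (σ j - σ i) • outerNormal K (x i) := by
  induction j, hij using Int.leInduction with
  | base => simp
  | succ j hij ih =>
    obtain ⟨hx, hy⟩ := ih fun a ha => hZ a ⟨ha.1, ha.2.trans (lt_add_one j).le⟩
    refine ⟨(h.stay j (hZ _ ⟨Int.lt_add_one_of_le hij, le_rfl⟩)).trans hx, ?_⟩
    rw [h.reflect, hx, hy]
    module

theorem nonempty (h : IsComponent K T m Z x y σ) (hK : IsNormBody K) : Z.Nonempty := by
  by_contra! hZ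
  have drift := (h.eq_of_forall_notMem h.pos.le fun a _ => hZ ▸ notMem_empty a).2
  rw [h.periodic_y.eq, eq_comm, sub_eq_self, smul_eq_zero, sub_eq_zero] at drift
  exact drift.elim (h.strictMono h.pos).ne' ((h.smooth_x 0).outerNormal_ne_zero hK)

theorem exists_last_mem (h : IsComponent K T m Z x y σ) (hK : IsNormBody K) (i : ℤ) :
    ∃ j ∈ Z, j ≤ i ∧ ∀ a ∈ Ioc j i, a ∉ Z := by
  obtain ⟨z, hz⟩ := h.nonempty hK
  have exists_le : ∃ j, j ≤ i ∧ j ∈ Z := by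
    refine ⟨z - (z - i).toNat * m, ?_, ?_⟩
    · have := Int.self_le_toNat (z - i)
      have := le_mul_of_one_le_right (Int.natCast_nonneg (z - i).toNat) h.pos
      lia
    · exact (h.periodic_mem.sub_nat_mul_eq _).mpr hz
  obtain ⟨j, ⟨hji, hj⟩, hmax⟩ := Int.exists_greatest_of_bdd ⟨i, fun _ ha => ha.1⟩ exists_le
  exact ⟨j, hj, hji, fun a ha haZ => (hmax a ⟨ha.2, haZ⟩).not_gt ha.1⟩

theorem exists_enumeration (h : IsComponent K T m Z x y σ) (hK : IsNormBody K) :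
    ∃ e : ℤ → ℤ, StrictMono e ∧ range e = Z := by
  have := h.pos
  refine exists_strictMono_range_eq Z (h.nonempty hK)
    (fun a b => (finite_Icc a b).subset inter_subset_right)
    (fun i hi => ⟨i + m, (h.periodic_mem i).mpr hi, by lia⟩)
    (fun i hi => ⟨i - m, (h.periodic_mem.sub_eq i).mpr hi, by lia⟩)

theorem isTimedTrajectory (h : IsComponent K T m Z x y σ) {e : ℤ → ℤ} (he : StrictMono e)
    (hr : range e = Z) : ∃ m', IsTimedTrajectory K T m' (x ∘ e) (y ∘ e) (σ ∘ e) := by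
  have e_mem (j : ℤ) : e j ∈ Z := hr ▸ mem_range_self j
  obtain ⟨m', hm'⟩ := exists_add_eq_of_range_invariant he (c := m) fun i => by
    rw [hr]; exact (h.periodic_mem i).to_iff.symm
  have before_next (j : ℤ) : x (e (j + 1) - 1) = x (e j) ∧
      y (e (j + 1) - 1) = y (e j) - (σ (e (j + 1) - 1) - σ (e j)) • outerNormal K (x (e j)) := by
    refine h.eq_of_forall_notMem (Int.le_sub_one_of_lt (he (lt_add_one j))) ?_
    rintro a ⟨hja, haj⟩ haZ
    obtain ⟨j', rfl⟩ := hr ▸ haZ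
    have := he.lt_iff_lt.1 hja
    have := he.lt_iff_lt.1 (Int.lt_of_le_sub_one haj)
    lia
  refine ⟨m', he.lt_iff_lt.1 ?_, fun j => ?_, fun j => ?_, fun j => h.smooth_x _,
    fun j => h.smooth_y _ (e_mem j), h.strictMono.comp he, fun j => ?_, fun j => ?_⟩
  · rw [← zero_add m', hm']
    exact lt_add_of_pos_right _ h.pos
  · simp only [Function.comp_apply, hm', h.periodic_x _]
  · simp only [Function.comp_apply, hm', h.periodic_y _]
  · have reflect := h.reflect (e (j + 1) - 1)
    rw [sub_add_cancel, (before_next j).1, (before_next j).2] at reflect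
    simp only [Function.comp_apply, reflect]
    module
  · simpa only [Function.comp_apply, sub_add_cancel, (before_next j).1] using
      h.move (e (j + 1) - 1) (by rw [sub_add_cancel]; exact e_mem _)

theorem exists_antipode (h : IsComponent K T m Z x y σ) (hK : IsNormBody K)
    (hA : IsAntipodal K T) :
    (∀ i ∈ Z, ∃ i' ∈ Z, σ i' = σ i + 2 ∧ x i' = -x i ∧ y i' = -y i) ∧
      ∀ i ∈ Z, ∃ i' ∈ Z, σ i = σ i' + 2 := by
  obtain ⟨e, he, rfl⟩ := h.exists_enumeration hK
  obtain ⟨m', ht⟩ := h.isTimedTrajectory he rfl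
  obtain ⟨M, hM⟩ := hA ht
  simp only [forall_mem_range, exists_range_iff]
  refine ⟨fun j => ⟨j + M, (hM j).2.2, (hM j).1, (hM j).2.1⟩, fun j => ⟨j - M, ?_⟩⟩
  simpa using (hM (j - M)).2.2

theorem antipodal_of_forall_mem (h : IsComponent K T m Z x y σ) (hK : IsNormBody K) {M : ℤ}
    (hσ : ∀ i, σ (i + M) = σ i + 2) (hZ : ∀ i, i ∉ Z → i + M ∉ Z)
    (hxy : ∀ i ∈ Z, x (i + M) = -x i ∧ y (i + M) = -y i) (i : ℤ) :
    x (i + M) = -x i ∧ y (i + M) = -y i := by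
  obtain ⟨j, hj, hji, hlast⟩ := h.exists_last_mem hK i
  obtain ⟨hx, hy⟩ := h.eq_of_forall_notMem hji hlast
  obtain ⟨hx', hy'⟩ := h.eq_of_forall_notMem (add_le_add_left hji M) fun a ha => by
    simpa using hZ (a - M) (hlast (a - M) ⟨by linarith [ha.1], by linarith [ha.2]⟩)
  obtain ⟨hxj, hyj⟩ := hxy j hj
  rw [hx', hy', hx, hy, hxj, hyj, hσ, hσ, (h.smooth_x j).outerNormal_neg hK]
  exact ⟨rfl, by module⟩

theorem exists_common_antipode {K T : Set (Fin k → ℝ)} {L S : Set (Fin l → ℝ)}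
    {x y : ℤ → Fin k → ℝ} {z w : ℤ → Fin l → ℝ} (hK : IsNormBody K) (hL : IsNormBody L)
    (h₁ : IsComponent K T m Z x y σ) (h₂ : IsComponent L S m Zᶜ z w σ) (hA₁ : IsAntipodal K T)
    (hA₂ : IsAntipodal L S) :
    ∃ M, ∀ i, (x (i + M) = -x i ∧ y (i + M) = -y i) ∧ (z (i + M) = -z i ∧ w (i + M) = -w i) ∧
      σ (i + M) = σ i + 2 := by
  obtain ⟨succ₁, pred₁⟩ := h₁.exists_antipode hK hA₁
  obtain ⟨succ₂, pred₂⟩ := h₂.exists_antipode hL hA₂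
  obtain ⟨M, hM⟩ := exists_add_eq_of_range_invariant h₁.strictMono (c := 2) fun s => by
    constructor
    · rintro ⟨i, rfl⟩
      by_cases hi : i ∈ Z
      · exact (succ₁ i hi).imp fun _ h => h.2.1
      · exact (succ₂ i hi).imp fun _ h => h.2.1
    · rintro ⟨i, hs⟩
      by_cases hi : i ∈ Z
      · exact (pred₁ i hi).imp fun _ h => by linarith
      · exact (pred₂ i hi).imp fun _ h => by linarith
  have antipode₁ (i : ℤ) (hi : i ∈ Z) : i + M ∈ Z ∧ x (i + M) = -x i ∧ y (i + M) = -y i := by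
    obtain ⟨i', hi', hσ, hxy⟩ := succ₁ i hi
    obtain rfl : i + M = i' := h₁.strictMono.injective (by rw [hM, hσ])
    exact ⟨hi', hxy⟩
  have antipode₂ (i : ℤ) (hi : i ∉ Z) : i + M ∉ Z ∧ z (i + M) = -z i ∧ w (i + M) = -w i := by
    obtain ⟨i', hi', hσ, hzw⟩ := succ₂ i hi
    obtain rfl : i + M = i' := h₁.strictMono.injective (by rw [hM, hσ])
    exact ⟨hi', hzw⟩
  exact ⟨M, fun i => ⟨h₁.antipodal_of_forall_mem hK hM (fun i hi => (antipode₂ i hi).1)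
    (fun i hi => (antipode₁ i hi).2) i, h₂.antipodal_of_forall_mem hL hM
    (fun i hi => not_not.2 (antipode₁ i (not_not.1 hi)).1) (fun i hi => (antipode₂ i hi).2) i,
    hM i⟩⟩

end IsComponent

theorem HasNormal.isSmoothBoundaryPoint_smul {n : ℕ} {K : Set (Fin n → ℝ)} {x w : Fin n → ℝ}
    (h : HasNormal K x w) (hK : IsNormBody K) {c : ℝ} (hc : 0 < c) (hx : gauge K x = c) :
    IsSmoothBoundaryPoint K (c⁻¹ • x) :=
  (h.smul (inv_pos.2 hc)).isSmoothBoundaryPoint hK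
    (by rw [hK.gauge_smul_of_pos (inv_pos.2 hc), hx, inv_mul_cancel₀ hc.ne'])

theorem IsTimedTrajectory.isComponent {N n : ℕ} {H R : Set (Fin N → ℝ)} {K T : Set (Fin n → ℝ)}
    {m : ℤ} {Z : Set ℤ} {q p : ℤ → Fin N → ℝ} {σ : ℤ → ℝ} (h : IsTimedTrajectory H R m q p σ)
    (hK : IsNormBody K) (π : (Fin N → ℝ) →L[ℝ] (Fin n → ℝ)) {c : ℝ} (hc : 0 < c)
    (periodic_mem : Function.Periodic (· ∈ Z) m)
    (gauge_eq : ∀ i, gauge K (π (q i)) = c)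
    (normal_q : ∀ i, HasNormal K (π (q i)) (π (outerNormal H (q i))))
    (smooth_p : ∀ i ∈ Z, IsSmoothBoundaryPoint T (π (p i)))
    (normal_p : ∀ i ∈ Z, π (outerNormal R (p i)) = outerNormal T (π (p i)))
    (normal_p_eq_zero : ∀ i ∉ Z, π (outerNormal R (p i)) = 0) :
    IsComponent K T m Z (fun i => c⁻¹ • π (q i)) (fun i => π (p i)) σ where
  pos := h.pos
  periodic_x i := by simp only [h.periodic_q i]
  periodic_y i := by simp only [h.periodic_p i]
  periodic_mem := periodic_mem
  smooth_x i := (normal_q i).isSmoothBoundaryPoint_smul hK hc (gauge_eq i)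
  smooth_y := smooth_p
  strictMono := h.strictMono
  reflect i := by
    rw [((normal_q i).smul (inv_pos.2 hc)).outerNormal_eq, h.reflect, map_sub, map_smul]
  stay i hi := by
    obtain ⟨b, -, hq⟩ := h.move i
    rw [hq, map_add, map_smul, normal_p_eq_zero _ hi, smul_zero, add_zero]
  move i hi := by
    obtain ⟨b, hb, hq⟩ := h.move i
    refine ⟨c⁻¹ * b, mul_pos (inv_pos.2 hc) hb, ?_⟩
    rw [hq, map_add, map_smul, normal_p _ hi, smul_add, smul_smul]

section Sum

variable {k l : ℕ} {K T : Set (Fin k → ℝ)} {L S : Set (Fin l → ℝ)}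

theorem IsSmoothBoundaryPoint.firstPart_of_oplusInf {p : Fin (k + l) → ℝ}
    (h : IsSmoothBoundaryPoint (oplusInf T S) p) (hT : IsNormBody T) (hS : IsNormBody S)
    (hlt : gauge S (lastPart p) < gauge T (firstPart p)) :
    IsSmoothBoundaryPoint T (firstPart p) ∧
      firstPart (outerNormal (oplusInf T S) p) = outerNormal T (firstPart p) ∧
      lastPart (outerNormal (oplusInf T S) p) = 0 := by
  obtain ⟨hfirst, hlast⟩ := (hasNormal_oplusInf_iff_left hT hS hlt).1 h.hasNormal
  refine ⟨hfirst.isSmoothBoundaryPoint hT ?_, hfirst.outerNormal_eq.symm, hlast⟩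
  rw [← h.gauge_eq_one (hT.oplusInf hS), gauge_oplusInf hT hS, max_eq_left hlt.le]

theorem IsSmoothBoundaryPoint.lastPart_of_oplusInf {p : Fin (k + l) → ℝ}
    (h : IsSmoothBoundaryPoint (oplusInf T S) p) (hT : IsNormBody T) (hS : IsNormBody S)
    (hlt : gauge T (firstPart p) < gauge S (lastPart p)) :
    IsSmoothBoundaryPoint S (lastPart p) ∧
      lastPart (outerNormal (oplusInf T S) p) = outerNormal S (lastPart p) ∧
      firstPart (outerNormal (oplusInf T S) p) = 0 := by
  obtain ⟨hfirst, hlast⟩ := (hasNormal_oplusInf_iff_right hT hS hlt).1 h.hasNormal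
  refine ⟨hlast.isSmoothBoundaryPoint hS ?_, hlast.outerNormal_eq.symm, hfirst⟩
  rw [← h.gauge_eq_one (hT.oplusInf hS), gauge_oplusInf hT hS, max_eq_right hlt.le]

namespace IsTimedTrajectory

variable {m : ℤ} {q p : ℤ → Fin (k + l) → ℝ} {σ : ℤ → ℝ}

theorem exists_gauge_parts_eq (h : IsTimedTrajectory (oplusOne K L) (oplusInf T S) m q p σ)
    (hK : IsNormBody K) (hL : IsNormBody L) (hT : IsNormBody T) (hS : IsNormBody S)
    (hk : 0 < k) (hl : 0 < l) :
    ∃ a b : ℝ, 0 < a ∧ 0 < b ∧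
      ∀ i, gauge K (firstPart (q i)) = a ∧ gauge L (lastPart (q i)) = b := by
  have gauge_sum (i : ℤ) : gauge K (firstPart (q i)) + gauge L (lastPart (q i)) = 1 :=
    gauge_oplusOne hK hL (q i) ▸ (h.smooth_q i).gauge_eq_one (hK.oplusOne hL)
  have gauge_first : Function.Periodic (fun i => gauge K (firstPart (q i))) 1 := by
    intro i
    obtain ⟨b, -, hq⟩ := h.move i
    have hp := h.smooth_p (i + 1)
    rcases lt_or_gt_of_ne (hp.hasNormal.gauge_ne hT hS hk) with hlt | hlt
    · simp [hq, (hp.lastPart_of_oplusInf hT hS hlt).2.2]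
    · have lastPart_eq : lastPart (q (i + 1)) = lastPart (q i) := by
        simp [hq, (hp.firstPart_of_oplusInf hT hS hlt).2.2]
      have := gauge_sum (i + 1)
      rw [lastPart_eq] at this
      linarith [gauge_sum i]
  obtain ⟨hfirst, hlast⟩ := (hasNormal_oplusOne_iff hK hL).1 (h.smooth_q 0).hasNormal
  refine ⟨_, _, hK.gauge_pos _ (hfirst.point_ne_zero hK hk),
    hL.gauge_pos _ (hlast.point_ne_zero hL hl), fun i => ?_⟩
  have := eq_of_periodic_one gauge_first i 0
  exact ⟨this, by linarith [gauge_sum i, gauge_sum 0]⟩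

theorem exists_isComponent (h : IsTimedTrajectory (oplusOne K L) (oplusInf T S) m q p σ)
    (hK : IsNormBody K) (hL : IsNormBody L) (hT : IsNormBody T) (hS : IsNormBody S)
    (hk : 0 < k) (hl : 0 < l) :
    ∃ (a b : ℝ) (Z : Set ℤ), 0 < a ∧ 0 < b ∧
      IsComponent K T m Z (fun i => a⁻¹ • firstPart (q i)) (fun i => firstPart (p i)) σ ∧
      IsComponent L S m Zᶜ (fun i => b⁻¹ • lastPart (q i)) (fun i => lastPart (p i)) σ := by
  obtain ⟨a, b, ha, hb, gauge_eq⟩ := h.exists_gauge_parts_eq hK hL hT hS hk hl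
  let Z : Set ℤ := {i | gauge S (lastPart (p i)) < gauge T (firstPart (p i))}
  have periodic_mem : Function.Periodic (· ∈ Z) m := fun i => by
    simp only [Z, mem_ofPred_eq, h.periodic_p i]
  have normal_q (i : ℤ) := (hasNormal_oplusOne_iff hK hL).1 (h.smooth_q i).hasNormal
  have of_mem (i : ℤ) (hi : i ∈ Z) := (h.smooth_p i).firstPart_of_oplusInf hT hS hi
  have of_notMem (i : ℤ) (hi : i ∉ Z) := (h.smooth_p i).lastPart_of_oplusInf hT hS
    ((not_lt.1 hi).lt_of_ne ((h.smooth_p i).hasNormal.gauge_ne hT hS hk))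
  exact ⟨a, b, Z, ha, hb,
    h.isComponent hK (firstPartCLM k l) ha periodic_mem (fun i => (gauge_eq i).1)
      (fun i => (normal_q i).1) (fun i hi => (of_mem i hi).1) (fun i hi => (of_mem i hi).2.1)
      (fun i hi => (of_notMem i hi).2.2),
    h.isComponent hL (lastPartCLM k l) hb (fun i => congrArg Not (periodic_mem i))
      (fun i => (gauge_eq i).2) (fun i => (normal_q i).2) (fun i hi => (of_notMem i hi).1)
      (fun i hi => (of_notMem i hi).2.1) (fun i hi => (of_mem i (not_not.1 hi)).2.2)⟩

end IsTimedTrajectory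

theorem IsAntipodal.sum (hk : 0 < k) (hl : 0 < l) (hK : IsNormBody K) (hT : IsNormBody T)
    (hL : IsNormBody L) (hS : IsNormBody S) (hKT : IsAntipodal K T) (hLS : IsAntipodal L S) :
    IsAntipodal (oplusOne K L) (oplusInf T S) := by
  intro m q p σ h
  obtain ⟨a, b, Z, ha, hb, component₁, component₂⟩ := h.exists_isComponent hK hL hT hS hk hl
  obtain ⟨M, hM⟩ := component₁.exists_common_antipode hK hL component₂ hKT hLS
  refine ⟨M, fun i => ?_⟩
  obtain ⟨⟨hx, hy⟩, ⟨hz, hw⟩, hσ⟩ := hM i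
  rw [← smul_neg] at hx hz
  exact ⟨parts_ext (smul_right_injective _ (inv_ne_zero ha.ne') hx)
    (smul_right_injective _ (inv_ne_zero hb.ne') hz), parts_ext hy hw, hσ⟩

end Sum

theorem IsHannerPair.isAntipodal {n : ℕ} {K T : Set (Fin n → ℝ)} (h : IsHannerPair n K T) :
    IsAntipodal K T := by
  induction h with
  | segment => exact .segment
  | symm h ih => exact ih.symm h.isNormBody.1 h.isNormBody.2
  | sum h₁ h₂ ih₁ ih₂ =>
    exact .sum h₁.dim_pos h₂.dim_pos h₁.isNormBody.1 h₁.isNormBody.2 h₂.isNormBody.1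
      h₂.isNormBody.2 ih₁ ih₂

/-! ### The total time of a simple trajectory -/

namespace IsTimedTrajectory

variable {n : ℕ} {K : Set (Fin n → ℝ)} {m : ℕ} {q p : ℤ → Fin n → ℝ} {σ : ℤ → ℝ}

theorem gauge_sub_le (hK : IsNormBody K) (hT : IsNormBody (polarBody K))
    (h : IsTimedTrajectory K (polarBody K) m q p σ) {i j : ℤ} (hle : i ≤ j) :
    gauge (polarBody K) (p i - p j) ≤ σ j - σ i := by
  induction j, hle using Int.leInduction with
  | base => simp
  | succ j _ ih =>
    have hpos : 0 < σ (j + 1) - σ j := sub_pos.2 (h.strictMono (lt_add_one j))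
    have normal_le : gauge (polarBody K) (outerNormal K (q j)) ≤ 1 :=
      hT.gauge_le_one_iff.2 ((h.smooth_q j).hasNormal.mem_polarBody hK)
    calc gauge (polarBody K) (p i - p (j + 1))
        = gauge (polarBody K) (p i - p j + (σ (j + 1) - σ j) • outerNormal K (q j)) := by
          rw [h.reflect, sub_sub_eq_add_sub, add_sub_right_comm]
      _ ≤ gauge (polarBody K) (p i - p j) +
            (σ (j + 1) - σ j) * gauge (polarBody K) (outerNormal K (q j)) := by
          rw [← hT.gauge_smul_of_pos hpos]
          exact hT.gauge_add_le _ _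
      _ ≤ σ (j + 1) - σ i := by nlinarith

theorem exists_half_period (h : IsTimedTrajectory K (polarBody K) m q p σ) (hK : IsNormBody K)
    (hT : IsNormBody (polarBody K)) (hA : IsAntipodal K (polarBody K)) :
    ∃ d : ℕ, 0 < d ∧ d < m ∧ ∀ i, q (i + d) = -q i ∧ σ (i + d) = σ i + 2 := by
  obtain ⟨M, hM⟩ := hA h
  lift M to ℕ using (h.strictMono.lt_iff_lt.1 (by rw [← zero_add M, (hM 0).2.2]; simp) : 0 < M).le
  have add_mod (i : ℤ) : i + ↑(M % m) = i + M - (M / m : ℤ) • (m : ℤ) := by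
    rw [Int.natCast_mod, Int.emod_def, smul_eq_mul]
    ring
  have q_add (i : ℤ) : q (i + ↑(M % m)) = -q i := by
    rw [add_mod, h.periodic_q.sub_zsmul_eq, (hM i).1]
  have p_add (i : ℤ) : p (i + ↑(M % m)) = -p i := by
    rw [add_mod, h.periodic_p.sub_zsmul_eq, (hM i).2.1]
  refine ⟨M % m, Nat.pos_of_ne_zero fun hzero => ?_, M.mod_lt (by exact_mod_cast h.pos),
    fun i => ⟨q_add i, le_antisymm ?_ ?_⟩⟩
  · have q_eq_zero : q 0 = 0 := self_eq_neg.1 (by simpa [hzero] using q_add 0)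
    simpa [q_eq_zero] using (h.smooth_q 0).gauge_eq_one hK
  · rw [← (hM i).2.2]
    exact h.strictMono.monotone (add_le_add_right (by exact_mod_cast M.mod_le m) i)
  · have speed_bound := gauge_sub_le hK hT h (le_add_of_nonneg_right (a := i) (M % m).cast_nonneg)
    rw [p_add, sub_neg_eq_add, ← two_smul ℝ (p i), hT.gauge_smul_of_pos two_pos,
      (h.smooth_p i).gauge_eq_one hT] at speed_bound
    linarith

theorem isClock_four (h : IsTimedTrajectory K (polarBody K) m q p σ) (hK : IsNormBody K)
    (hT : IsNormBody (polarBody K)) (hA : IsAntipodal K (polarBody K))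
    (simple : ∀ d : ℕ, 0 < d → d < m → ¬Function.Periodic q d) : IsClock m 4 σ := by
  obtain ⟨d, d_pos, d_lt, hd⟩ := h.exists_half_period hK hT hA
  have periodic_two_mul : Function.Periodic q ↑(2 * d) := fun i => by
    rw [Nat.cast_mul, Nat.cast_two, two_mul, ← add_assoc, (hd _).1, (hd i).1, neg_neg]
  have two_mul_eq : 2 * d = m := by
    rcases lt_trichotomy (2 * d) m with hlt | heq | hgt
    · exact absurd periodic_two_mul (simple _ (by lia) hlt)
    · exact heq
    · refine absurd (periodic_two_mul.sub_period h.periodic_q) ?_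
      rw [← Nat.cast_sub hgt.le]
      exact simple _ (by lia) (by lia)
  refine ⟨four_pos, h.strictMono, fun i => ?_⟩
  rw [← two_mul_eq, Nat.cast_mul, Nat.cast_two, two_mul, ← add_assoc, (hd _).2, (hd i).2]
  ring

end IsTimedTrajectory

theorem IsClassicalTrajectory.exists_isTimedTrajectory {n : ℕ} {K T : Set (Fin n → ℝ)} {m : ℕ}
    {q p : ℤ → Fin n → ℝ} (h : IsClassicalTrajectory K T m q p) (i₀ : ℤ) :
    ∃ σ, σ i₀ = 0 ∧ IsTimedTrajectory K T m q p σ := by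
  choose a ha hreflect using fun i => (h.step i).reflect
  obtain ⟨σ, hσ₀, hσ⟩ := exists_antidifference a i₀
  refine ⟨σ, hσ₀, by exact_mod_cast two_pos.trans_le h.two_le, h.periodic_q, h.periodic_p,
    fun i => (h.step i).smooth_q, fun i => (h.step i).smooth_p,
    strictMono_int_of_lt_succ fun i => by linarith [hσ i, ha i], fun i => ?_,
    fun i => (h.step i).move.imp fun _ hb => hb.imp_right sub_eq_iff_eq_add'.1⟩
  rw [hσ, add_sub_cancel_left, sub_eq_add_neg, ← hreflect, add_sub_cancel]

theorem IsSimpleClassicalTrajectory.exists_isClock {n : ℕ} {K : Set (Fin n → ℝ)} {m : ℕ}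
    {q p : ℤ → Fin n → ℝ} (h : IsSimpleClassicalTrajectory K (polarBody K) m q p)
    (hK : IsHanner n K) (i₀ : ℤ) :
    ∃ σ, σ i₀ = 0 ∧ IsTimedTrajectory K (polarBody K) m q p σ ∧ IsClock m 4 σ := by
  obtain ⟨σ, hσ₀, hσ⟩ := h.exists_isTimedTrajectory i₀
  have hpair := hK.isHannerPair
  exact ⟨σ, hσ₀, hσ, hσ.isClock_four hpair.isNormBody.1 hpair.isNormBody.2 hpair.isAntipodal
    h.simple⟩

/-! ### Closed polygonal lines -/

theorem polygonPoint_add {n : ℕ} (R : ℤ → Fin n → ℝ) (j : ℤ) {c : ℝ} (hc : c ∈ Ico (0 : ℝ) 1) :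
    polygonPoint R (j + c) = AffineMap.lineMap (R j) (R (j + 1)) c := by
  rw [polygonPoint, Int.floor_intCast_add, Int.floor_eq_zero_iff.2 hc, add_zero,
    Int.fract_intCast_add, Int.fract_eq_self.2 hc]

theorem sameClosedPolygon_comp {n : ℕ} (R : ℤ → Fin n → ℝ) {N m : ℕ} {u : ℤ → ℤ}
    (hu : Monotone u) (huN : ∀ i, u (i + N) = u i + m) (hsurj : Function.Surjective u) :
    SameClosedPolygon N (fun i => R (u i)) m R := by
  refine ⟨fun i => u i, Int.cast_mono.comp hu, fun i => ?_, fun i => ?_, fun j => ?_⟩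
  · simp [huN]
  · simpa using (polygonPoint_add R (u i) (c := 0) (by simp)).symm
  · exact (hsurj j).imp fun i hi => congrArg _ hi

theorem IsMerge.sameClosedPolygon {n : ℕ} {P R : ℤ → Fin n → ℝ} {N m : ℕ} {u v : ℤ → ℤ}
    {σ₁ σ₂ t : ℤ → ℝ} {period : ℝ} (h : IsMerge σ₁ σ₂ t u v) (h₁ : IsClock m period σ₁)
    (ht : IsClock N period t)
    (hP : ∀ i, P i = AffineMap.lineMap (R (u i)) (R (u i + 1))
      ((t i - σ₁ (u i)) / (σ₁ (u i + 1) - σ₁ (u i)))) : SameClosedPolygon N P m R := by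
  have edge_pos (j : ℤ) : 0 < σ₁ (j + 1) - σ₁ j := sub_pos.2 (h₁.strictMono (lt_add_one j))
  have fraction_mem (i : ℤ) :
      (t i - σ₁ (u i)) / (σ₁ (u i + 1) - σ₁ (u i)) ∈ Ico (0 : ℝ) 1 := by
    rw [mem_Ico, div_lt_one (edge_pos _), sub_lt_sub_iff_right]
    exact ⟨div_nonneg (sub_nonneg.2 (h.mem_left i).1) (edge_pos _).le, (h.mem_left i).2⟩
  refine ⟨fun i => u i + (t i - σ₁ (u i)) / (σ₁ (u i + 1) - σ₁ (u i)), fun i j hij => ?_,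
    fun i => ?_, fun i => ?_, fun j => ?_⟩
  · dsimp only
    rcases (h.monotone_left hij).eq_or_lt with heq | hlt
    · rw [heq]
      have := h.strictMono.monotone hij
      have := (edge_pos (u j)).le
      gcongr
    · have : (u i : ℝ) + 1 ≤ u j := by exact_mod_cast hlt
      linarith [(fraction_mem i).2, (fraction_mem j).1]
  · dsimp only
    rw [h.left_add_period h₁ ht.add_period, add_right_comm (u i), ht.add_period, h₁.add_period,
      h₁.add_period, add_sub_add_right_eq_sub, add_sub_add_right_eq_sub]
    push_cast
    ring
  · rw [polygonPoint_add R _ (fraction_mem i), hP]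
  · obtain ⟨i, rfl, hi⟩ := h.exists_left_eq j
    exact ⟨i, by simp [hi]⟩

/-! ### Merging two trajectories -/

/-- The momentum at time `s` of a particle that starts from `p j` at time `σ j` and moves with
velocity `-outerNormal K (q j)`. -/
noncomputable def momentumAt {n : ℕ} (K : Set (Fin n → ℝ)) (q p : ℤ → Fin n → ℝ) (σ : ℤ → ℝ)
    (j : ℤ) (s : ℝ) : Fin n → ℝ :=
  p j - (s - σ j) • outerNormal K (q j)

theorem momentumAt_self {n : ℕ} (K : Set (Fin n → ℝ)) (q p : ℤ → Fin n → ℝ) (σ : ℤ → ℝ) (j : ℤ) :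
    momentumAt K q p σ j (σ j) = p j := by
  simp [momentumAt]

namespace IsTimedTrajectory

variable {n : ℕ} {K T : Set (Fin n → ℝ)} {m : ℤ} {q p : ℤ → Fin n → ℝ} {σ : ℤ → ℝ}

theorem add_const (h : IsTimedTrajectory K T m q p σ) (c : ℝ) :
    IsTimedTrajectory K T m q p fun i => σ i + c :=
  { h with
    strictMono := h.strictMono.add_const c
    reflect := fun i => by rw [add_sub_add_right_eq_sub, h.reflect] }

theorem succ_ne (h : IsTimedTrajectory K T m q p σ) (hT : IsNormBody T) (i : ℤ) :
    q (i + 1) ≠ q i := by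
  obtain ⟨b, hb, hq⟩ := h.move i
  rw [hq, Ne, add_eq_left, smul_eq_zero, not_or]
  exact ⟨hb.ne', (h.smooth_p _).outerNormal_ne_zero hT⟩

theorem billiardStep (h : IsTimedTrajectory K T m q p σ) (i : ℤ) :
    BilliardStep K T (q i) (p i) (q (i + 1)) (p (i + 1)) where
  smooth_q := h.smooth_q i
  smooth_p := h.smooth_p i
  smooth_q' := h.smooth_q (i + 1)
  smooth_p' := h.smooth_p (i + 1)
  reflect := ⟨_, sub_pos.2 (h.strictMono (lt_add_one i)), by rw [h.reflect, sub_sub_cancel_left]⟩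
  move := (h.move i).imp fun _ hb => hb.imp_right sub_eq_iff_eq_add'.2

theorem momentumAt_lineMap (h : IsTimedTrajectory K T m q p σ) (j : ℤ) (c : ℝ) :
    momentumAt K q p σ j (AffineMap.lineMap (σ j) (σ (j + 1)) c) =
      AffineMap.lineMap (p j) (p (j + 1)) c := by
  simp only [momentumAt, AffineMap.lineMap_apply_module', h.reflect j, smul_eq_mul]
  module

theorem momentumAt_eq_lineMap (h : IsTimedTrajectory K T m q p σ) (j : ℤ) (s : ℝ) :
    momentumAt K q p σ j s =
      AffineMap.lineMap (p j) (p (j + 1)) ((s - σ j) / (σ (j + 1) - σ j)) := by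
  rw [← h.momentumAt_lineMap, AffineMap.lineMap_apply_module', smul_eq_mul,
    div_mul_cancel₀ _ (sub_pos.2 (h.strictMono (lt_add_one j))).ne', sub_add_cancel]

theorem momentumAt_succ (h : IsTimedTrajectory K T m q p σ) (j : ℤ) :
    momentumAt K q p σ j (σ (j + 1)) = p (j + 1) := by
  simpa using h.momentumAt_lineMap j 1

theorem momentumAt_add_period {P : ℝ} (h : IsTimedTrajectory K T m q p σ) (hσ : IsClock m P σ)
    (j : ℤ) (s : ℝ) : momentumAt K q p σ (j + m) (s + P) = momentumAt K q p σ j s := by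
  rw [momentumAt, h.periodic_q, h.periodic_p, hσ.add_period, add_sub_add_right_eq_sub, momentumAt]

theorem gauge_momentumAt_lt (h : IsTimedTrajectory K T m q p σ) (hT : IsNormBody T)
    (hKT : TransversalNormals K T) {j : ℤ} {s : ℝ} (hs : s ∈ Ioo (σ j) (σ (j + 1))) :
    gauge T (momentumAt K q p σ j s) < 1 := by
  rw [momentumAt, sub_eq_add_neg, ← smul_neg]
  refine (h.smooth_p j).hasNormal.gauge_chord_lt hT ((h.smooth_p j).gauge_eq_one hT) ?_
    (a := σ (j + 1) - σ j) ?_ (sub_pos.2 hs.1) (sub_lt_sub_right hs.2 _)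
  · simpa using hKT.symm (h.smooth_p j).hasNormal (h.smooth_q j).hasNormal
  · rw [smul_neg, ← sub_eq_add_neg, ← h.reflect, (h.smooth_p _).gauge_eq_one hT]

end IsTimedTrajectory

theorem IsMerge.momentumAt_succ {n : ℕ} {K T : Set (Fin n → ℝ)} {m : ℤ} {q p : ℤ → Fin n → ℝ}
    {σ₁ σ₂ t : ℤ → ℝ} {u v : ℤ → ℤ} (h : IsMerge σ₁ σ₂ t u v)
    (h₁ : IsTimedTrajectory K T m q p σ₁) (i : ℤ) :
    momentumAt K q p σ₁ (u (i + 1)) (t (i + 1)) =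
      momentumAt K q p σ₁ (u i) (t i) - (t (i + 1) - t i) • outerNormal K (q (u i)) := by
  have drift (s : ℝ) : momentumAt K q p σ₁ (u i) s =
      momentumAt K q p σ₁ (u i) (t i) - (s - t i) • outerNormal K (q (u i)) := by
    simp only [momentumAt]
    module
  rw [← drift]
  rcases h.isLeftEvent_or i with event | event
  · rw [event.time_eq, momentumAt_self, event.left_succ, h₁.momentumAt_succ]
  · rw [event.right_succ]

section Merge

variable {k l : ℕ} {K T : Set (Fin k → ℝ)} {L S : Set (Fin l → ℝ)}

theorem IsSmoothBoundaryPoint.append_oplusOne {x : Fin k → ℝ} {y : Fin l → ℝ}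
    (hx : IsSmoothBoundaryPoint K x) (hy : IsSmoothBoundaryPoint L y) (hK : IsNormBody K)
    (hL : IsNormBody L) {α : ℝ} (hα : α ∈ Ioo (0 : ℝ) 1) :
    IsSmoothBoundaryPoint (oplusOne K L) (Fin.append (α • x) ((1 - α) • y)) ∧
      outerNormal (oplusOne K L) (Fin.append (α • x) ((1 - α) • y)) =
        Fin.append (outerNormal K x) (outerNormal L y) := by
  have hα' : 0 < 1 - α := sub_pos.2 hα.2
  have normal : HasNormal (oplusOne K L) (Fin.append (α • x) ((1 - α) • y))
      (Fin.append (outerNormal K x) (outerNormal L y)) := by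
    simp only [hasNormal_oplusOne_iff hK hL, firstPart_append, lastPart_append]
    exact ⟨hx.hasNormal.smul hα.1, hy.hasNormal.smul hα'⟩
  refine ⟨normal.isSmoothBoundaryPoint (hK.oplusOne hL) ?_, normal.outerNormal_eq⟩
  simp [gauge_oplusOne hK hL, hK.gauge_smul_of_pos hα.1, hL.gauge_smul_of_pos hα',
    hx.gauge_eq_one hK, hy.gauge_eq_one hL]

theorem IsSmoothBoundaryPoint.append_oplusInf_left {x : Fin k → ℝ} {y : Fin l → ℝ}
    (hx : IsSmoothBoundaryPoint T x) (hT : IsNormBody T) (hS : IsNormBody S)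
    (hy : gauge S y < 1) :
    IsSmoothBoundaryPoint (oplusInf T S) (Fin.append x y) ∧
      outerNormal (oplusInf T S) (Fin.append x y) = Fin.append (outerNormal T x) 0 := by
  have gauge_x : gauge T x = 1 := hx.gauge_eq_one hT
  have normal : HasNormal (oplusInf T S) (Fin.append x y) (Fin.append (outerNormal T x) 0) := by
    rw [hasNormal_oplusInf_iff_left hT hS (by simpa [gauge_x] using hy)]
    simpa using hx.hasNormal
  refine ⟨normal.isSmoothBoundaryPoint (hT.oplusInf hS) ?_, normal.outerNormal_eq⟩
  simp [gauge_oplusInf hT hS, gauge_x, hy.le]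

theorem IsSmoothBoundaryPoint.append_oplusInf_right {x : Fin k → ℝ} {y : Fin l → ℝ}
    (hy : IsSmoothBoundaryPoint S y) (hT : IsNormBody T) (hS : IsNormBody S)
    (hx : gauge T x < 1) :
    IsSmoothBoundaryPoint (oplusInf T S) (Fin.append x y) ∧
      outerNormal (oplusInf T S) (Fin.append x y) = Fin.append 0 (outerNormal S y) := by
  have gauge_y : gauge S y = 1 := hy.gauge_eq_one hS
  have normal : HasNormal (oplusInf T S) (Fin.append x y) (Fin.append 0 (outerNormal S y)) := by
    rw [hasNormal_oplusInf_iff_right hT hS (by simpa [gauge_y] using hx)]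
    simpa using hy.hasNormal
  refine ⟨normal.isSmoothBoundaryPoint (hT.oplusInf hS) ?_, normal.outerNormal_eq⟩
  simp [gauge_oplusInf hT hS, gauge_y, hx.le]

/-- The positions of the trajectory in `oplusOne K L` made of two trajectories, shrunk by `α` and
`1 - α`, when `u i` and `v i` count the bounces of the two trajectories up to the `i`-th event. -/
def mergedPosition (α : ℝ) (q₁ : ℤ → Fin k → ℝ) (q₂ : ℤ → Fin l → ℝ) (u v : ℤ → ℤ) (i : ℤ) :
    Fin (k + l) → ℝ :=
  Fin.append (α • q₁ (u i)) ((1 - α) • q₂ (v i))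

/-- The momenta of the trajectory in `oplusOne K L` made of two trajectories: both momenta at the
time `t i` of the `i`-th event, when `u i` and `v i` count the bounces up to that time. -/
noncomputable def mergedMomentum (K : Set (Fin k → ℝ)) (L : Set (Fin l → ℝ))
    (q₁ p₁ : ℤ → Fin k → ℝ) (q₂ p₂ : ℤ → Fin l → ℝ) (σ₁ σ₂ t : ℤ → ℝ) (u v : ℤ → ℤ) (i : ℤ) :
    Fin (k + l) → ℝ :=
  Fin.append (momentumAt K q₁ p₁ σ₁ (u i) (t i)) (momentumAt L q₂ p₂ σ₂ (v i) (t i))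

variable {m₁ m₂ : ℤ} {q₁ p₁ : ℤ → Fin k → ℝ} {q₂ p₂ : ℤ → Fin l → ℝ} {σ₁ σ₂ t : ℤ → ℝ}
  {u v : ℤ → ℤ} {P α : ℝ}

theorem IsLeftEvent.momentumAt_eq {i : ℤ} (h : IsLeftEvent σ₁ σ₂ t u v i) (K : Set (Fin k → ℝ))
    (q p : ℤ → Fin k → ℝ) :
    momentumAt K q p σ₁ (u (i + 1)) (t (i + 1)) = p (u (i + 1)) := by
  rw [h.time_eq, momentumAt_self]

namespace IsMerge

theorem smooth_and_move (h : IsMerge σ₁ σ₂ t u v) (h₁ : IsTimedTrajectory K T m₁ q₁ p₁ σ₁)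
    (h₂ : IsTimedTrajectory L S m₂ q₂ p₂ σ₂) (hT : IsNormBody T) (hS : IsNormBody S)
    (hKT : TransversalNormals K T) (hLS : TransversalNormals L S) (hα : α ∈ Ioo (0 : ℝ) 1)
    (i : ℤ) :
    IsSmoothBoundaryPoint (oplusInf T S) (mergedMomentum K L q₁ p₁ q₂ p₂ σ₁ σ₂ t u v (i + 1)) ∧
      ∃ b : ℝ, 0 < b ∧ mergedPosition α q₁ q₂ u v (i + 1) = mergedPosition α q₁ q₂ u v i +
        b • outerNormal (oplusInf T S)
          (mergedMomentum K L q₁ p₁ q₂ p₂ σ₁ σ₂ t u v (i + 1)) := by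
  simp only [mergedMomentum, mergedPosition]
  rcases h.isLeftEvent_or i with event | event
  · have inner := h₂.gauge_momentumAt_lt hS hLS ⟨event.lt_time, (h.mem_right (i + 1)).2⟩
    obtain ⟨smooth, normal⟩ := (h₁.smooth_p (u (i + 1))).append_oplusInf_left hT hS inner
    obtain ⟨b, hb, hq⟩ := h₁.move (u i)
    rw [event.momentumAt_eq, normal]
    refine ⟨smooth, α * b, mul_pos hα.1 hb, ?_⟩
    rw [event.right_succ, event.left_succ, hq]
    apply parts_ext <;> simp [mul_smul]
  · have inner := h₁.gauge_momentumAt_lt hT hKT ⟨event.lt_time, (h.mem_left (i + 1)).2⟩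
    obtain ⟨smooth, normal⟩ := (h₂.smooth_p (v (i + 1))).append_oplusInf_right hT hS inner
    obtain ⟨b, hb, hq⟩ := h₂.move (v i)
    rw [event.momentumAt_eq, normal]
    refine ⟨smooth, (1 - α) * b, mul_pos (sub_pos.2 hα.2) hb, ?_⟩
    rw [event.right_succ, event.left_succ, hq]
    apply parts_ext <;> simp [mul_smul]

theorem isTimedTrajectory (h : IsMerge σ₁ σ₂ t u v) (h₁ : IsTimedTrajectory K T m₁ q₁ p₁ σ₁)
    (h₂ : IsTimedTrajectory L S m₂ q₂ p₂ σ₂) (clock₁ : IsClock m₁ P σ₁) (clock₂ : IsClock m₂ P σ₂)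
    (hK : IsNormBody K) (hL : IsNormBody L) (hT : IsNormBody T) (hS : IsNormBody S)
    (hKT : TransversalNormals K T) (hLS : TransversalNormals L S) (hα : α ∈ Ioo (0 : ℝ) 1) :
    IsTimedTrajectory (oplusOne K L) (oplusInf T S) (m₁ + m₂) (mergedPosition α q₁ q₂ u v)
      (mergedMomentum K L q₁ p₁ q₂ p₂ σ₁ σ₂ t u v) t := by
  have clock := h.isClock clock₁ clock₂
  have step := h.smooth_and_move h₁ h₂ hT hS hKT hLS hα
  have smooth_q (i : ℤ) := (h₁.smooth_q (u i)).append_oplusOne (h₂.smooth_q (v i)) hK hL hα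
  have u_add := h.left_add_period clock₁ clock.add_period
  have v_add := h.symm.left_add_period clock₂ clock.add_period
  refine ⟨add_pos h₁.pos h₂.pos, fun i => ?_, fun i => ?_, fun i => (smooth_q i).1,
    fun i => ?_, h.strictMono, fun i => ?_, fun i => (step i).2⟩
  · simp only [mergedPosition, u_add, v_add, h₁.periodic_q _, h₂.periodic_q _]
  · simp only [mergedMomentum, u_add, v_add, clock.add_period, h₁.momentumAt_add_period clock₁,
      h₂.momentumAt_add_period clock₂]
  · simpa using (step (i - 1)).1
  · rw [mergedPosition, (smooth_q i).2, mergedMomentum, mergedMomentum, h.momentumAt_succ h₁,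
      h.symm.momentumAt_succ h₂]
    apply parts_ext <;> simp

theorem not_periodic_mergedPosition {N m : ℕ} (h : IsMerge σ₁ σ₂ t u v)
    (h₁ : IsTimedTrajectory K T m q₁ p₁ σ₁) (hT : IsNormBody T) (clock₁ : IsClock m P σ₁)
    (clock : IsClock N P t) (simple : ∀ d : ℕ, 0 < d → d < m → ¬Function.Periodic q₁ d)
    (hα : α ≠ 0) {d : ℕ} (hd : 0 < d) (hdN : d < N) :
    ¬Function.Periodic (mergedPosition α q₁ q₂ u v) d := by
  intro hper
  refine not_periodic_comp (h₁.succ_ne hT) simple h.surjective_left h.left_succ_eq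
    (by exact_mod_cast h₁.pos) (h.left_add_period clock₁ clock.add_period) hd hdN
    fun i => smul_right_injective _ hα ?_
  simpa [mergedPosition] using congrArg firstPart (hper i)

theorem isSimpleClassicalTrajectory {m₁ m₂ : ℕ} (h : IsMerge σ₁ σ₂ t u v)
    (h₁ : IsTimedTrajectory K T m₁ q₁ p₁ σ₁) (h₂ : IsTimedTrajectory L S m₂ q₂ p₂ σ₂)
    (clock₁ : IsClock m₁ P σ₁) (clock₂ : IsClock m₂ P σ₂)
    (simple : ∀ d : ℕ, 0 < d → d < m₁ → ¬Function.Periodic q₁ d)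
    (hK : IsNormBody K) (hL : IsNormBody L) (hT : IsNormBody T) (hS : IsNormBody S)
    (hKT : TransversalNormals K T) (hLS : TransversalNormals L S) (hα : α ∈ Ioo (0 : ℝ) 1) :
    IsSimpleClassicalTrajectory (oplusOne K L) (oplusInf T S) (m₁ + m₂)
      (mergedPosition α q₁ q₂ u v) (mergedMomentum K L q₁ p₁ q₂ p₂ σ₁ σ₂ t u v) := by
  have merged := h.isTimedTrajectory h₁ h₂ clock₁ clock₂ hK hL hT hS hKT hLS hα
  have clock : IsClock (m₁ + m₂ : ℕ) P t := by exact_mod_cast h.isClock clock₁ clock₂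
  have two_le : 2 ≤ m₁ + m₂ := by
    have := h₁.pos
    have := h₂.pos
    lia
  exact ⟨⟨two_le, by exact_mod_cast merged.periodic_q, by exact_mod_cast merged.periodic_p,
    merged.billiardStep⟩,
    fun _ => h.not_periodic_mergedPosition h₁ hT clock₁ clock simple hα.1.ne'⟩

theorem sameClosedPolygon_position {n m N : ℕ} (h : IsMerge σ₁ σ₂ t u v) (R : ℤ → Fin n → ℝ)
    (clock₁ : IsClock m P σ₁) (clock : IsClock N P t) :
    SameClosedPolygon N (fun i => R (u i)) m R :=
  sameClosedPolygon_comp R h.monotone_left (h.left_add_period clock₁ clock.add_period)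
    h.surjective_left

theorem sameClosedPolygon_momentum {m N : ℕ} (h : IsMerge σ₁ σ₂ t u v)
    (h₁ : IsTimedTrajectory K T m q₁ p₁ σ₁) (clock₁ : IsClock m P σ₁) (clock : IsClock N P t) :
    SameClosedPolygon N (fun i => momentumAt K q₁ p₁ σ₁ (u i) (t i)) m p₁ :=
  h.sameClosedPolygon clock₁ clock fun i => h₁.momentumAt_eq_lineMap (u i) (t i)

end IsMerge

theorem exists_merged_trajectory {m₁ m₂ : ℕ} (h₁ : IsTimedTrajectory K T m₁ q₁ p₁ σ₁)
    (h₂ : IsTimedTrajectory L S m₂ q₂ p₂ σ₂) (clock₁ : IsClock m₁ P σ₁) (clock₂ : IsClock m₂ P σ₂)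
    (simple : ∀ d : ℕ, 0 < d → d < m₁ → ¬Function.Periodic q₁ d)
    (hK : IsNormBody K) (hL : IsNormBody L) (hT : IsNormBody T) (hS : IsNormBody S)
    (hKT : TransversalNormals K T) (hLS : TransversalNormals L S) (hα : α ∈ Ioo (0 : ℝ) 1)
    (hne : ∀ i j, σ₁ i ≠ σ₂ j) {β : ℝ} (hβ : β ∈ Ioo (0 : ℝ) 1)
    (hσ : σ₂ 1 = AffineMap.lineMap (σ₁ 2) (σ₁ 1) β) :
    ∃ (N : ℕ) (q p : ℤ → Fin (k + l) → ℝ),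
      IsSimpleClassicalTrajectory (oplusOne K L) (oplusInf T S) N q p ∧
      q 1 = Fin.append (α • q₁ 1) ((1 - α) • q₂ 1) ∧
      p 1 = Fin.append (β • p₁ 1 + (1 - β) • p₁ 2) (p₂ 1) ∧
      SameClosedPolygon N (fun i => firstPart (q i)) m₁ (fun i => α • q₁ i) ∧
      SameClosedPolygon N (fun i => lastPart (q i)) m₂ (fun i => (1 - α) • q₂ i) ∧
      SameClosedPolygon N (fun i => firstPart (p i)) m₁ p₁ ∧
      SameClosedPolygon N (fun i => lastPart (p i)) m₂ p₂ := by
  obtain ⟨t, u, v, merge, ht⟩ := exists_isMerge clock₁ clock₂ hne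
  have clock : IsClock (m₁ + m₂ : ℕ) P t := by exact_mod_cast merge.isClock clock₁ clock₂
  have t_eq : t 1 = AffineMap.lineMap (σ₁ 1) (σ₁ (1 + 1)) (1 - β) := by
    rw [ht, hσ, AffineMap.lineMap_apply_one_sub, one_add_one_eq_two]
  have edge_lt : σ₁ 1 < σ₁ (1 + 1) := clock₁.strictMono (lt_add_one 1)
  have u_one : u 1 = 1 := merge.left_eq <| t_eq ▸
    ⟨((left_lt_lineMap_iff_lt (sub_pos.2 hβ.2)).2 edge_lt).le,
      (lineMap_lt_right_iff_lt (sub_lt_self 1 hβ.1)).2 edge_lt⟩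
  have v_one : v 1 = 1 := merge.symm.left_eq_of_time_eq ht
  refine ⟨m₁ + m₂, mergedPosition α q₁ q₂ u v, mergedMomentum K L q₁ p₁ q₂ p₂ σ₁ σ₂ t u v,
    merge.isSimpleClassicalTrajectory h₁ h₂ clock₁ clock₂ simple hK hL hT hS hKT hLS hα,
    by rw [mergedPosition, u_one, v_one], ?_, ?_, ?_, ?_, ?_⟩
  · rw [mergedMomentum, u_one, v_one, t_eq, h₁.momentumAt_lineMap, ← t_eq, ht, momentumAt_self,
      AffineMap.lineMap_apply_module, sub_sub_cancel, one_add_one_eq_two]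
  · simpa [mergedPosition] using merge.sameClosedPolygon_position (fun i => α • q₁ i) clock₁ clock
  · simpa [mergedPosition] using
      merge.symm.sameClosedPolygon_position (fun i => (1 - α) • q₂ i) clock₂ clock
  · simpa [mergedMomentum] using merge.sameClosedPolygon_momentum h₁ clock₁ clock
  · simpa [mergedMomentum] using merge.symm.sameClosedPolygon_momentum h₂ clock₂ clock

end Merge

theorem mainTheorem4 {k l : ℕ} (K : Set (Fin k → ℝ)) (L : Set (Fin l → ℝ))
    (hK : IsHanner k K) (hL : IsHanner l L)
    (m₁ m₂ : ℕ) (q₁ p₁ : ℤ → Fin k → ℝ) (q₂ p₂ : ℤ → Fin l → ℝ)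
    (h₁ : IsSimpleClassicalTrajectory K (polarBody K) m₁ q₁ p₁)
    (h₂ : IsSimpleClassicalTrajectory L (polarBody L) m₂ q₂ p₂)
    (α : ℝ) (hα : α ∈ Set.Ioo (0 : ℝ) 1) :
    {β : ℝ | β ∈ Set.Ioo (0 : ℝ) 1 ∧
      ¬ ∃ (N : ℕ) (q p : ℤ → Fin (k + l) → ℝ),
        -- a simple classical trajectory with the prescribed initial data
        IsSimpleClassicalTrajectory (oplusOne K L) (polarBody (oplusOne K L)) N q p ∧
        q 1 = Fin.append (α • q₁ 1) ((1 - α) • q₂ 1) ∧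
        p 1 = Fin.append (β • p₁ 1 + (1 - β) • p₁ 2) (p₂ 1) ∧
        -- it is the only extension of the initial data by the billiard rules
        (∀ q' p' : ℕ → Fin (k + l) → ℝ, q' 0 = q 1 → p' 0 = p 1 →
          (∀ i, BilliardStep (oplusOne K L) (polarBody (oplusOne K L))
            (q' i) (p' i) (q' (i + 1)) (p' (i + 1))) →
          ∀ i : ℕ, q' i = q (i + 1) ∧ p' i = p (i + 1)) ∧
        -- projections of the coordinate line
        SameClosedPolygon N (fun i => firstPart (q i)) m₁ (fun i => α • q₁ i) ∧
        SameClosedPolygon N (fun i => lastPart (q i)) m₂ (fun i => (1 - α) • q₂ i) ∧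
        -- projections of the momentum line
        SameClosedPolygon N (fun i => firstPart (p i)) m₁ p₁ ∧
        SameClosedPolygon N (fun i => lastPart (p i)) m₂ p₂}.Finite := by
  obtain ⟨σ₁, σ₁_one, timed₁, clock₁⟩ := h₁.exists_isClock hK 1
  obtain ⟨σ₂, σ₂_one, timed₂, clock₂⟩ := h₂.exists_isClock hL 1
  have pair₁ := hK.isHannerPair
  have pair₂ := hL.isHannerPair
  have pair := (hK.sumOne hL).isHannerPair
  have edge_ne : σ₁ 2 ≠ 0 := (σ₁_one ▸ clock₁.strictMono one_lt_two).ne'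
  refine (clock₁.finite_coincidences_delay clock₂ edge_ne).subset ?_
  rintro β ⟨hβ, not_extendable⟩
  by_contra! hne
  refine not_extendable ?_
  obtain ⟨N, q, p, trajectory, q_one, p_one, polygons⟩ := exists_merged_trajectory timed₁
    (timed₂.add_const ((1 - β) * σ₁ 2)) clock₁ (clock₂.add_const _) h₁.simple pair₁.isNormBody.1
    pair₂.isNormBody.1 pair₁.isNormBody.2 pair₂.isNormBody.2 pair₁.transversalNormals
    pair₂.transversalNormals hα (fun i j hij => hne ⟨Ioo_subset_Icc_self hβ, i, j, hij⟩) hβ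
    (by simp [σ₁_one, σ₂_one, AffineMap.lineMap_apply_module])
  rw [← polarBody_oplusOne pair₁.isNormBody.1 pair₂.isNormBody.1 pair₁.isNormBody.2
    pair₂.isNormBody.2] at trajectory
  exact ⟨N, q, p, trajectory, q_one, p_one, fun q' p' hq hp => trajectory.forward_unique
    pair.isNormBody.1 pair.isNormBody.2 pair.transversalNormals hq hp, polygons⟩
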